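/- Fix $n\ge 1$ and write $[m]=\{1,\dots,m\}$. Let $\lambda=(\lambda_1\ge\dots\ge\lambda_n\ge 0)$ be a partition with at most $n$ parts, with column lengths $\zeta_1\ge\zeta_2\ge\dots$. Let $R=R_\lambda=\{q_1<\dots<q_r\}$ be the set of column lengths of $\lambda$ that are less than $n$, and put $q_0=0$, $q_{r+1}=n$. The intervals $(q_{h-1},q_h]$, $1\le h\le r+1$, are called carrels. For a finite set $Q$ of integers, $\mathrm{rank}^d(Q)$ is its $d$-th largest element. **Tuples.** A $\lambda$-tuple is a tuple $\nu\in[n]^n$. It is *upper* if $\nu_i\ge i$ for all $i$, an *upper flag* if it is upper and weakly increasing, and *$\lambda$-increasing* if it is strictly increasing on each carrel. A *$\lambda$-permutation* is a $\lambda$-increasing permutation of $[n]$; it is *$\lambda$-312-avoiding* if there are no $a<b<c$ in three distinct carrels with $\pi_b<\pi_c<\pi_a$. *Critical indices and the core.* For an upper tuple $\upsilon$, the last index of each carrel is critical; if $x$ is critical, the next critical index to its left in the same carrel is the largest $y<x$ in that carrel with $\upsilon_x-\upsilon_y>x-y$, if one exists. The *$\lambda$-core* $\Delta_\lambda(\upsilon)$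 has $i$-th entry $\upsilon_x-(x-i)$, where $x$ is the smallest critical index with $x\ge i$. An upper tuple $\upsilon$ is a *gapless core $\lambda$-tuple* if for $1\le h\le r$ one has $\upsilon_{q_h}\le\upsilon_k$, where $k$ is the leftmost critical index of the $(h+1)$-st carrel. A *gapless $\lambda$-tuple* is a gapless core $\lambda$-tuple that is $\lambda$-increasing. *The map $\Psi_\lambda$.* For a $\lambda$-permutation $\pi$ and $i\in(q_{h-1},q_h]$, $\Psi_\lambda(\pi)_i=\mathrm{rank}^{q_h-i+1}\{\pi_1,\dots,\pi_{q_h}\}$. *The map $\Pi_\lambda$.* For a gapless $\lambda$-tuple $\gamma$, the tuple $\pi=\Pi_\lambda(\gamma)$ is defined carrel by carrel. On the first carrel $\pi_i=\gamma_i$. For $1\le h\le r$ let $s=\gamma_{q_h}-\gamma_{q_h+1}+1$ if $\gamma_{q_h}\ge\gamma_{q_h+1}$, and $s=0$ otherwise. Then $\pi_i=\gamma_i$ for $i\in(q_h+s,q_{h+1}]$, and $\pi_i=\mathrm{rank}^{\,q_h+s-i+1}\big([\gamma_{q_h}]\setminus\{\pi_1,\dots,\pi_{q_h}\}\big)$ for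 $i\in(q_h,q_h+s]$. **Tableaux and polynomials.** Let $\mathcal T_\lambda$ be the set of semistandard tableaux of shape $\lambda$ with values in $[n]$. For $T\in\mathcal T_\lambda$ let $x^{\Theta(T)}=\prod_v x_v^{\#\{v\text{'s in }T\}}$. For an upper tuple $\beta$ let $\mathcal S_\lambda(\beta)$ be the set of $T\in\mathcal T_\lambda$ all of whose values in row $i$ are at most $\beta_i$, for all $i$. For $T\in\mathcal T_\lambda$ the *scanning tableau* (right key) $S(T)$ has the following $j$-th column. Delete the columns of $T$ to the left of column $j$. Start with the bottom value of column $j$; going to the right, mark this value and then every bottom unmarked value of a column that is at least the last value marked. The last value marked is the bottom entry of column $j$ of $S(T)$. Repeat with the unmarked values to obtain the entries of column $j$ of $S(T)$ from bottom to top. For a $\lambda$-permutation $\pi$, the *key* $Y_\lambda(\pi)$ is the tableau of shape $\lambda$ whose column of length $\zeta$ has the value set $\{\pi_1,\dots,\pi_\zeta\}$. Let $\mathcal D_\lambda(\pi)=\{T\in\mathcal T_\lambda: S(T)\le Y_\lambda(\pi)\text{ entrywise}\}$. Put $s_\lambda(\beta;x)=\sum_{T\in\mathcal S_\lambda(\beta)}x^{\Theta(T)}$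 and $d_\lambda(\pi;x)=\sum_{T\in\mathcal D_\lambda(\pi)}x^{\Theta(T)}$. The latter are the *Demazure polynomials*, and $s_\lambda(\varphi;x)$ is a *flag Schur polynomial* when $\varphi$ is an upper flag. Two such sums are *identical*, written $\equiv$, if their underlying tableau sets are equal (which implies that the polynomials are equal). **Theorem 10.2.** (i) If $\eta$ is a gapless core $\lambda$-tuple, then $\pi:=\Pi_\lambda(\Delta_\lambda(\eta))$ is a $\lambda$-312-avoiding $\lambda$-permutation and $s_\lambda(\eta;x)\equiv d_\lambda(\pi;x)$. (ii) If $\pi$ is a $\lambda$-312-avoiding $\lambda$-permutation, then $\gamma:=\Psi_\lambda(\pi)$ is a gapless $\lambda$-tuple and $d_\lambda(\pi;x)\equiv s_\lambda(\gamma;x)$. (iii) Every flag Schur polynomial $s_\lambda(\varphi;x)$ is identical to exactly one Demazure polynomial (of any shape), and there is exactly one $\lambda$-permutation $\pi$ with $s_\lambda(\varphi;x)\equiv d_\lambda(\pi;x)$. Every Demazure polynomial $d_\lambda(\pi;x)$ with $\pi$ $\lambda$-312-avoiding is identical to exactly one flag Schur polynomial (of any shape); moreover any two upper flags $\varphi,\varphi'$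 with $s_\lambda(\varphi;x)\equiv d_\lambda(\pi;x)\equiv s_\lambda(\varphi';x)$ satisfy $\Delta_\lambda(\varphi)=\Delta_\lambda(\varphi')$. (Here, in "exactly one", flag Schur and Demazure polynomials are counted up to $\equiv$.) -/

import Mathlib

/-!
Conventions.  `[n] = {1, …, n}` is modelled by `Fin n`, so indices of tuples, entries of tuples and
values of tableaux are all shifted down by one.  A divider position `q ∈ R ⊆ [n - 1]` separates the
first `q` indices `0, …, q - 1` from the remaining ones; it is not shifted.
An `nn`-tuple is a function `Fin n → Fin n`.
-/

namespace ParabolicCatalan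

/-- The `d`-th largest element of `Q` (for `1 ≤ d ≤ |Q|`; otherwise the unused value `dflt`). -/
def rankLargest {n : ℕ} (d : ℕ) (Q : Finset (Fin n)) (dflt : Fin n) : Fin n :=
  (Q.sort (· ≥ ·)).getD (d - 1) dflt

section Tuples

variable {n : ℕ}

/-- No divider of `R` separates the indices `i` and `j`. -/
def SameCarrel (R : Finset ℕ) (i j : Fin n) : Prop :=
  ∀ q ∈ R, (q ≤ (i : ℕ) ↔ q ≤ (j : ℕ))

instance (R : Finset ℕ) (i j : Fin n) : Decidable (SameCarrel R i j) := by
  unfold SameCarrel; infer_instance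

/-- The carrel that contains the index `i`. -/
def carrel (R : Finset ℕ) (i : Fin n) : Finset (Fin n) :=
  Finset.univ.filter fun j => SameCarrel R i j

theorem mem_carrel_self (R : Finset ℕ) (i : Fin n) : i ∈ carrel R i :=
  Finset.mem_filter.mpr ⟨Finset.mem_univ i, fun _ _ => Iff.rfl⟩

theorem carrel_nonempty (R : Finset ℕ) (i : Fin n) : (carrel R i).Nonempty :=
  ⟨i, mem_carrel_self R i⟩

/-- The first index of the carrel of `i`. -/
def carrelFirst (R : Finset ℕ) (i : Fin n) : Fin n := (carrel R i).min' (carrel_nonempty R i)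

/-- The last index of the carrel of `i`. -/
def carrelLast (R : Finset ℕ) (i : Fin n) : Fin n := (carrel R i).max' (carrel_nonempty R i)

/-- Upper tuples: `ν_i ≥ i`. -/
def IsUpper (ν : Fin n → Fin n) : Prop := ∀ i, i ≤ ν i

/-- Upper flags: upper tuples that are weakly increasing. -/
def IsUpperFlag (ν : Fin n → Fin n) : Prop := IsUpper ν ∧ Monotone ν

/-- `R`-increasing tuples: strictly increasing on each carrel. -/
def IsRIncreasing (R : Finset ℕ) (ν : Fin n → Fin n) : Prop :=
  ∀ i j, i < j → SameCarrel R i j → ν i < ν j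

/-- `R`-permutations. -/
def IsRPermutation (R : Finset ℕ) (π : Fin n → Fin n) : Prop :=
  Function.Injective π ∧ IsRIncreasing R π

/-- `R`-312-containing: there are `a < b < c` in three distinct carrels with `π_b < π_c < π_a`. -/
def Contains312 (R : Finset ℕ) (π : Fin n → Fin n) : Prop :=
  ∃ q ∈ R, ∃ q' ∈ R, ∃ a b c : Fin n,
    (a : ℕ) < q ∧ q ≤ (b : ℕ) ∧ (b : ℕ) < q' ∧ q' ≤ (c : ℕ) ∧
      π b < π a ∧ π b < π c ∧ π c < π a

/-- `R`-312-avoiding `R`-permutations. -/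
def IsR312Avoiding (R : Finset ℕ) (π : Fin n → Fin n) : Prop :=
  IsRPermutation R π ∧ ¬ Contains312 R π

/-- The first `m` entries of `π`, as a set. -/
def firstEntries (π : Fin n → Fin n) (m : ℕ) : Finset (Fin n) :=
  (Finset.univ.filter fun k : Fin n => (k : ℕ) < m).image π

/-- The rank tuple `Ψ_R(π)`: with `q` the right end of the carrel of `i` and `B` the set of the
first `q` entries of `π`, the entry at the (one-based) index `i` is the `(q - i + 1)`-st largest
element of `B`. -/
def rankTuple (R : Finset ℕ) (π : Fin n → Fin n) (i : Fin n) : Fin n :=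
  let q := (carrelLast R i : ℕ) + 1
  rankLargest (q - i) (firstEntries π q) i

/-- Critical indices of an upper tuple `υ`.  The last index of each carrel is critical; if `x` is
critical then the next critical index to the left in the same carrel is the largest `y < x` in that
carrel such that `υ_x - υ_y > x - y`, if there is one. -/
inductive IsCritical (R : Finset ℕ) (υ : Fin n → Fin n) : Fin n → Prop
  | last (x : Fin n) : carrelLast R x = x → IsCritical R υ x
  | next (x y : Fin n) : IsCritical R υ x → y < x → SameCarrel R y x →
      (υ y : ℕ) + x < υ x + y →
      (∀ z, y < z → z < x → ¬ ((υ z : ℕ) + x < υ x + z)) →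
      IsCritical R υ y

open scoped Classical in
/-- The critical indices at or to the right of `i`. -/
noncomputable def criticalFrom (R : Finset ℕ) (υ : Fin n → Fin n) (i : Fin n) :
    Finset (Fin n) :=
  Finset.univ.filter fun x => i ≤ x ∧ IsCritical R υ x

theorem criticalFrom_nonempty (R : Finset ℕ) (υ : Fin n → Fin n) (i : Fin n) :
    (criticalFrom R υ i).Nonempty := by
  have hi : i ∈ carrel R i := mem_carrel_self R i
  have hm : SameCarrel R i (carrelLast R i) :=
    (Finset.mem_filter.mp (Finset.max'_mem _ (carrel_nonempty R i))).2
  have hc : carrel R (carrelLast R i) = carrel R i := by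
    ext j
    simp only [carrel, Finset.mem_filter, Finset.mem_univ, true_and]
    exact ⟨fun h q hq => (hm q hq).trans (h q hq), fun h q hq => (hm q hq).symm.trans (h q hq)⟩
  refine ⟨carrelLast R i, ?_⟩
  simp only [criticalFrom, Finset.mem_filter, Finset.mem_univ, true_and]
  refine ⟨Finset.le_max' _ _ hi, IsCritical.last _ ?_⟩
  simp only [carrelLast] at hc ⊢
  simp only [hc]

/-- The nearest critical index at or to the right of `i`. -/
noncomputable def nextCritical (R : Finset ℕ) (υ : Fin n → Fin n) (i : Fin n) : Fin n :=
  (criticalFrom R υ i).min' (criticalFrom_nonempty R υ i)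

/-- The `R`-core `Δ_R(υ)`: its entry at `i` is `υ_x - (x - i)`, where `x` is the nearest critical
index at or to the right of `i`. -/
noncomputable def core (R : Finset ℕ) (υ : Fin n → Fin n) (i : Fin n) : Fin n :=
  let x := nextCritical R υ i
  ⟨(υ x : ℕ) - ((x : ℕ) - i), lt_of_le_of_lt (Nat.sub_le _ _) (υ x).isLt⟩

/-- Gapless core `R`-tuples: upper tuples such that, for any two consecutive carrels, the entry at
the end of the first one is at most the entry at the leftmost critical index of the second one. -/
def IsGaplessCore (R : Finset ℕ) (υ : Fin n → Fin n) : Prop :=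
  IsUpper υ ∧ ∀ e f : Fin n, (e : ℕ) + 1 = f → ¬ SameCarrel R e f →
    υ e ≤ υ (nextCritical R υ f)

/-- Gapless `R`-tuples. -/
def IsGapless (R : Finset ℕ) (γ : Fin n → Fin n) : Prop :=
  IsGaplessCore R γ ∧ IsRIncreasing R γ

/-- The map `Π_R`.  On the first carrel `π_i = γ_i`.  On a later carrel let `g` be the entry of `γ`
just before the carrel, let `g'` be the first entry of `γ` in the carrel, and let
`s = g - g' + 1` if `g ≥ g'` and `s = 0` otherwise.  The first `s` positions of the carrel receive,
from right to left, the largest, second largest, … elements of `[g]` that do not occur in `π` in the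
earlier carrels; on the other positions `π_i = γ_i`. -/
def gaplessToPerm (R : Finset ℕ) (γ : Fin n → Fin n) (i : Fin n) : Fin n :=
  let q : Fin n := carrelFirst R i
  if (q : ℕ) = 0 then γ i
  else
    let g : Fin n := γ ⟨(q : ℕ) - 1, lt_of_le_of_lt (Nat.sub_le _ _) q.isLt⟩
    let s : ℕ := if γ q ≤ g then (g : ℕ) - γ q + 1 else 0
    if (q : ℕ) + s ≤ i then γ i
    else
      let used : Finset (Fin n) :=
        (Finset.univ.filter fun k : Fin n => k < carrelFirst R i).attach.image fun k =>
          gaplessToPerm R γ k.1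
      rankLargest ((q : ℕ) + s - i) (Finset.univ.filter (fun v => v ≤ g) \ used) i
termination_by (i : ℕ)
decreasing_by
  have hk : k.1 < carrelFirst R i := (Finset.mem_filter.mp k.2).2
  have hi : carrelFirst R i ≤ i :=
    Finset.min'_le _ _ (mem_carrel_self R i)
  exact lt_of_lt_of_le hk hi

end Tuples

section Tableaux

/-!
A partition with at most `n` parts is a Young diagram `μ` with `μ.colLen 0 ≤ n`.  Rows and columns
are indexed from `0`, and the cell `(i, j)` lies in row `i` and column `j`.
-/

/-- `R_λ`: the set of column lengths of the shape that are less than `n`. -/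
def colLengths (n : ℕ) (μ : YoungDiagram) : Finset ℕ :=
  ((Finset.range (μ.rowLen 0)).image μ.colLen).filter fun q => q < n

theorem finite_tableaux (n : ℕ) (μ : YoungDiagram) :
    {T : SemistandardYoungTableau μ | ∀ i j, (i, j) ∈ μ → T i j < n}.Finite := by
  refine Set.Finite.of_injOn (t := (Set.univ : Set (μ.cells → Fin (n + 1))))
    (f := fun T c => Fin.ofNat (n + 1) (T c.1.1 c.1.2)) (fun _ _ => Set.mem_univ _) ?_
    Set.finite_univ
  intro T hT T' hT' h
  ext i j
  by_cases hc : (i, j) ∈ μ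
  · have h1 := congrArg Fin.val (congrFun h ⟨(i, j), hc⟩)
    have h2 := hT i j hc
    have h3 := hT' i j hc
    simpa [Fin.ofNat, Nat.mod_eq_of_lt (Nat.lt_succ_of_lt h2),
      Nat.mod_eq_of_lt (Nat.lt_succ_of_lt h3)] using h1
  · rw [T.zeros hc, T'.zeros hc]

/-- Semistandard tableaux of shape `μ` with values from `[n]`. -/
noncomputable def tableaux (n : ℕ) (μ : YoungDiagram) : Finset (SemistandardYoungTableau μ) :=
  (finite_tableaux n μ).toFinset

open scoped Classical in
/-- The row bound set `S_λ(β)`.  The condition `i ≤ β i` comes from the latent inert column. -/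
noncomputable def rowBoundSet {n : ℕ} (μ : YoungDiagram) (β : Fin n → Fin n) :
    Finset (SemistandardYoungTableau μ) :=
  (tableaux n μ).filter fun T =>
    (∀ i : Fin n, i ≤ β i) ∧ ∀ (i : Fin n) (j : ℕ), ((i : ℕ), j) ∈ μ → T i j ≤ β i

/-- One scanning path.  Each list holds the unmarked values of a column, from bottom to top.
Going through the columns from left to right, whenever the bottom unmarked value of a column is at
least the last value `v` taken, it is taken and marked.  The result is the final value taken, and
the columns without the newly marked values. -/
def scanPath : ℕ → List (List ℕ) → ℕ × List (List ℕ)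
  | v, [] => (v, [])
  | v, [] :: cs => ((scanPath v cs).1, [] :: (scanPath v cs).2)
  | v, (x :: c) :: cs =>
      if v ≤ x then ((scanPath x cs).1, c :: (scanPath x cs).2)
      else ((scanPath v cs).1, (x :: c) :: (scanPath v cs).2)

/-- The final values of the successive scanning paths that start at the values (from bottom to top)
of a first column, where the second argument lists the columns to its right. -/
def scanColumn : List ℕ → List (List ℕ) → List ℕ
  | [], _ => []
  | x :: c, cs => (scanPath x cs).1 :: scanColumn c (scanPath x cs).2

/-- Column `j` of `T`, from bottom to top. -/
def columnUp {μ : YoungDiagram} (T : SemistandardYoungTableau μ) (j : ℕ) : List ℕ :=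
  ((List.range (μ.colLen j)).map fun i => T i j).reverse

/-- The scanning tableau `S(T)` (the right key of `T`): its `j`-th column consists, from bottom to
top, of the final values of the scanning paths of the columns `j, j + 1, …` of `T` that start in
column `j`.  The value is relevant only for `(i, j) ∈ μ`. -/
def scan {μ : YoungDiagram} (T : SemistandardYoungTableau μ) (i j : ℕ) : ℕ :=
  (scanColumn (columnUp T j)
    ((List.range (μ.rowLen 0 - (j + 1))).map fun k => columnUp T (j + 1 + k))).reverse.getD i 0

/-- The `λ`-key `Y_λ(π)` of an `R_λ`-permutation: the column `j`, of length `ζ`, has the first `ζ`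
entries of `π` as its values, in increasing order.  (On a column of length `n` these are all
elements of `[n]`.)  The value is relevant only for `(i, j) ∈ μ`. -/
def keyEntry {n : ℕ} (μ : YoungDiagram) (π : Fin n → Fin n) (i : Fin n) (j : ℕ) : Fin n :=
  rankLargest (μ.colLen j - i) (firstEntries π (μ.colLen j)) i

open scoped Classical in
/-- The set `D_λ(π)` of Demazure tableaux: `S(T) ≤ Y_λ(π)` entrywise. -/
noncomputable def demazureSet {n : ℕ} (μ : YoungDiagram) (π : Fin n → Fin n) :
    Finset (SemistandardYoungTableau μ) :=
  (tableaux n μ).filter fun T =>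
    ∀ (i : Fin n) (j : ℕ), ((i : ℕ), j) ∈ μ → scan T i j ≤ keyEntry μ π i j

end Tableaux

section Polynomials

/-- A sum of weights of tableaux, remembered together with the (finite) set of tableaux summed. -/
@[ext]
structure TableauSum (n : ℕ) where
  /-- The underlying set of tableaux. -/
  support : Finset (Σ μ : YoungDiagram, SemistandardYoungTableau μ)

/-- The content of a tableau: the number of its values equal to `v`. -/
def content {μ : YoungDiagram} (T : SemistandardYoungTableau μ) (v : ℕ) : ℕ :=
  (μ.cells.filter fun c => T c.1 c.2 = v).card

/-- The polynomial `∑ x^Θ(T)` in `x_1, …, x_n`. -/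
noncomputable def TableauSum.poly {n : ℕ} (f : TableauSum n) : MvPolynomial (Fin n) ℤ :=
  ∑ T ∈ f.support, ∏ v : Fin n, MvPolynomial.X v ^ content T.2 v

/-- `f ≡ g`: identical as generating functions, i.e. the underlying tableau sets coincide. -/
def TableauSum.Identical {n : ℕ} (f g : TableauSum n) : Prop := f.support = g.support

/-- The sum of the weights over a finite set of tableaux of shape `μ`. -/
def TableauSum.ofShape (n : ℕ) {μ : YoungDiagram} (P : Finset (SemistandardYoungTableau μ)) :
    TableauSum n :=
  ⟨P.map ⟨fun T => ⟨μ, T⟩, sigma_mk_injective⟩⟩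

/-- The row bound sum `s_λ(β; x)`. -/
noncomputable def rowBoundSum {n : ℕ} (μ : YoungDiagram) (β : Fin n → Fin n) : TableauSum n :=
  TableauSum.ofShape n (rowBoundSet μ β)

/-- The Demazure polynomial `d_λ(π; x)`. -/
noncomputable def demazureSum {n : ℕ} (μ : YoungDiagram) (π : Fin n → Fin n) : TableauSum n :=
  TableauSum.ofShape n (demazureSet μ π)

/-- `f` is a flag Schur polynomial `s_λ(φ; x)`, for some partition `λ` with at most `n` parts and
some upper flag `φ`. -/
def IsFlagSchur {n : ℕ} (f : TableauSum n) : Prop :=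
  ∃ (μ : YoungDiagram) (φ : Fin n → Fin n),
    μ.colLen 0 ≤ n ∧ IsUpperFlag φ ∧ f = rowBoundSum μ φ

/-- `f` is a Demazure polynomial `d_λ(π; x)`, for some partition `λ` with at most `n` parts and
some `R_λ`-permutation `π`. -/
def IsDemazure {n : ℕ} (f : TableauSum n) : Prop :=
  ∃ (μ : YoungDiagram) (π : Fin n → Fin n),
    μ.colLen 0 ≤ n ∧ IsRPermutation (colLengths n μ) π ∧ f = demazureSum μ π

end Polynomials

end ParabolicCatalan

open ParabolicCatalan

namespace ParabolicCatalan

/-! ### Scanning paths on lists -/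

/-! Columns are strictly increasing, and every column length is the end of a carrel. So a row bound
`β` acts on a tableau only through its core: if `x` is the nearest critical index at or after `i`, a
column meeting row `i` also meets row `x`, and its entry in row `i` is at most `β x - (x - i)`
(`mem_rowBoundSet_iff_core`). A gapless core tuple may therefore be replaced by any upper flag with
the same core, and `ceiling` is one.

The heart is `demazureSet_eq_rowBoundSet`: if `π` avoids 312 and a flag `φ` has core equal to the
rank tuple of `π`, then the Demazure set of `π` is the row bound set of `φ`. In one direction, the
last column meeting row `i` ends with the carrel of `i`, so its key entry is the rank tuple at `i`;
moreover `T` lies below its scanning tableau. In the other direction, scanning preserves weakly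
increasing row bounds (`scan_le_of_monotone`), the strict columns of the scanning tableau turn the
bound `φ` into its core, and 312-avoidance turns a bound by the rank tuple into a bound by the key
(`IsR312Avoiding.le_rankLargest`).

To match tuples with permutations, gaplessness is expressed by `HasRuns`. Rank tuples of
312-avoiding permutations have runs. Conversely, for an upper increasing tuple with runs,
`CarrelForm` describes `gaplessToPerm` on one carrel; it gives a 312-avoiding permutation whose rank
tuple is the given tuple.

Uniqueness comes from keys: the key of `π` is the entrywise largest element of its Demazure set, and
its columns give the sets of first entries of `π` at the ends of carrels, which determine `π`
(`eq_of_demazureSet_eq`). -/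

theorem le_scanPath_fst : ∀ (cs : List (List ℕ)) (v : ℕ), v ≤ (scanPath v cs).1
  | [], v => le_rfl
  | [] :: cs, v => le_scanPath_fst cs v
  | (x :: c) :: cs, v => by
    rw [scanPath]
    split_ifs with h
    · exact h.trans (le_scanPath_fst cs x)
    · exact le_scanPath_fst cs v

/-- Only bottom unmarked values are ever marked, so what survives of a column is an upper part of
it. Invariants of the columns pass through repeated scans by this fact alone. -/
theorem scanPath_snd_suffix : ∀ (cs : List (List ℕ)) (v : ℕ),
    List.Forall₂ (· <:+ ·) (scanPath v cs).2 cs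
  | [], v => List.Forall₂.nil
  | [] :: cs, v => List.Forall₂.cons List.suffix_rfl (scanPath_snd_suffix cs v)
  | (x :: c) :: cs, v => by
    rw [scanPath]
    split_ifs with h
    · exact List.Forall₂.cons (List.suffix_cons x c) (scanPath_snd_suffix cs x)
    · exact List.Forall₂.cons List.suffix_rfl (scanPath_snd_suffix cs v)

theorem exists_mem_of_forall₂_suffix {cs ds : List (List ℕ)} (h : List.Forall₂ (· <:+ ·) ds cs)
    {d : List ℕ} (hd : d ∈ ds) : ∃ c ∈ cs, d <:+ c := by
  induction h with
  | nil => simp at hd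
  | cons h1 _ ih =>
    rcases List.mem_cons.1 hd with rfl | hd
    · exact ⟨_, List.mem_cons_self, h1⟩
    · obtain ⟨c, hc, h⟩ := ih hd
      exact ⟨c, List.mem_cons_of_mem _ hc, h⟩

/-- A property of columns that is inherited by upper parts of columns survives scanning. -/
theorem scanPath_snd_forall {P : List ℕ → Prop} (hP : ∀ l l', l' <:+ l → P l → P l')
    {cs : List (List ℕ)} (h : ∀ l ∈ cs, P l) (v : ℕ) : ∀ l ∈ (scanPath v cs).2, P l := by
  intro l hl
  obtain ⟨c, hc, hs⟩ := exists_mem_of_forall₂_suffix (scanPath_snd_suffix cs v) hl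
  exact hP c l hs (h c hc)

theorem pairwise_of_forall₂_suffix {r : List ℕ → List ℕ → Prop}
    (hr : ∀ a b a' b', a' <:+ a → b' <:+ b → r a b → r a' b') {cs ds : List (List ℕ)}
    (h : List.Forall₂ (· <:+ ·) ds cs) (hp : cs.Pairwise r) : ds.Pairwise r := by
  induction h with
  | nil => exact List.Pairwise.nil
  | cons h1 h2 ih =>
    rw [List.pairwise_cons] at hp ⊢
    refine ⟨fun d hd => ?_, ih hp.2⟩
    obtain ⟨c, hc, hs⟩ := exists_mem_of_forall₂_suffix h2 hd
    exact hr _ _ _ _ h1 hs (hp.1 c hc)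

/-- The second path stays strictly below the first at every column. If the first takes `x`, the
second sees a value below `x` or nothing; if the first passes over `x`, then `x < v`, so the second
remains below `v` whether or not it takes `x`. -/
theorem scanPath_fst_lt : ∀ (cs : List (List ℕ)) (v w : ℕ), w < v →
    (∀ l ∈ cs, l.Pairwise (· > ·)) → (scanPath w (scanPath v cs).2).1 < (scanPath v cs).1
  | [], v, w, h, _ => h
  | [] :: cs, v, w, h, hc =>
    scanPath_fst_lt cs v w h fun l hl => hc l (List.mem_cons_of_mem _ hl)
  | (x :: c) :: cs, v, w, h, hc => by
    have hcs : ∀ l ∈ cs, l.Pairwise (· > ·) := fun l hl => hc l (List.mem_cons_of_mem _ hl)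
    have hx := hc (x :: c) List.mem_cons_self
    rw [scanPath]
    split_ifs with hv
    · cases c with
      | nil => exact scanPath_fst_lt cs x w (by omega) hcs
      | cons y c =>
        have hy : y < x := (List.pairwise_cons.1 hx).1 y List.mem_cons_self
        simp only [scanPath]
        split_ifs
        · exact scanPath_fst_lt cs x y hy hcs
        · exact scanPath_fst_lt cs x w (by omega) hcs
    · simp only [scanPath]
      split_ifs
      · exact scanPath_fst_lt cs v x (by omega) hcs
      · exact scanPath_fst_lt cs v w h hcs

theorem length_scanColumn : ∀ (l : List ℕ) (cs : List (List ℕ)),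
    (scanColumn l cs).length = l.length
  | [], _ => rfl
  | x :: c, cs => by simp [scanColumn, length_scanColumn c]

theorem le_getElem_scanColumn : ∀ (l : List ℕ) (cs : List (List ℕ)) (k : ℕ) (h : k < l.length),
    l[k] ≤ (scanColumn l cs)[k]'((length_scanColumn l cs).symm ▸ h)
  | x :: c, cs, 0, _ => le_scanPath_fst cs x
  | x :: c, cs, k + 1, h => le_getElem_scanColumn c _ k (by simpa using h)

theorem scanColumn_isChain : ∀ (l : List ℕ) (cs : List (List ℕ)), l.Pairwise (· > ·) →
    (∀ c ∈ cs, c.Pairwise (· > ·)) → (scanColumn l cs).IsChain (· > ·)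
  | [], _, _, _ => List.isChain_nil
  | [x], _, _, _ => List.isChain_singleton _
  | x :: y :: c, cs, hl, hcs => by
    have ih := scanColumn_isChain (y :: c) (scanPath x cs).2 (List.pairwise_cons.1 hl).2
      (scanPath_snd_forall (fun _ _ hs hp => hp.sublist hs.sublist) hcs x)
    simp only [scanColumn] at ih ⊢
    exact List.IsChain.cons_cons
      (scanPath_fst_lt cs x y ((List.pairwise_cons.1 hl).1 y List.mem_cons_self) hcs) ih

/-- Scanning from a column that contains all values to its right changes nothing. -/
theorem scanPath_eq_self_of_le : ∀ (cs : List (List ℕ)) (x : ℕ), (∀ c ∈ cs, c.Pairwise (· > ·)) →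
    (∀ c ∈ cs, ∀ y ∈ c, y ≤ x) →
    (scanPath x cs).1 = x ∧ ∀ c ∈ (scanPath x cs).2, ∀ y ∈ c, y < x
  | [], x, _, _ => ⟨rfl, by simp [scanPath]⟩
  | [] :: cs, x, h, h' => by
    obtain ⟨h1, h2⟩ := scanPath_eq_self_of_le cs x (fun l hl => h l (List.mem_cons_of_mem _ hl))
      (fun l hl => h' l (List.mem_cons_of_mem _ hl))
    refine ⟨h1, ?_⟩
    intro c hc
    rcases List.mem_cons.1 hc with rfl | hc
    · simp
    · exact h2 c hc
  | (z :: c) :: cs, x, h, h' => by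
    obtain ⟨h1, h2⟩ := scanPath_eq_self_of_le cs x (fun l hl => h l (List.mem_cons_of_mem _ hl))
      (fun l hl => h' l (List.mem_cons_of_mem _ hl))
    have hz : z ≤ x := h' _ List.mem_cons_self z List.mem_cons_self
    have hc := List.pairwise_cons.1 (h _ List.mem_cons_self)
    rw [scanPath]
    split_ifs with hxz
    · obtain rfl : x = z := le_antisymm hxz hz
      refine ⟨h1, fun l hl => ?_⟩
      rcases List.mem_cons.1 hl with rfl | hl
      · exact hc.1
      · exact h2 l hl
    · refine ⟨h1, fun l hl => ?_⟩
      rcases List.mem_cons.1 hl with rfl | hl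
      · intro y hy
        rcases List.mem_cons.1 hy with rfl | hy
        · omega
        · have := hc.1 y hy
          omega
      · exact h2 l hl

/-- The first path ends where it starts and leaves only values below `x` in the other columns, which
are then contained in `c`. The induction can continue there. -/
theorem scanColumn_eq_self : ∀ (l : List ℕ) (cs : List (List ℕ)), l.Pairwise (· > ·) →
    (∀ c ∈ cs, c.Pairwise (· > ·)) → (∀ c ∈ cs, c ⊆ l) → scanColumn l cs = l
  | [], _, _, _, _ => rfl
  | x :: c, cs, hl, hcs, hsub => by
    have hx := List.pairwise_cons.1 hl
    obtain ⟨h1, h2⟩ := scanPath_eq_self_of_le cs x hcs (by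
      intro d hd y hy
      rcases List.mem_cons.1 (hsub d hd hy) with rfl | hy
      · exact le_rfl
      · exact (hx.1 y hy).le)
    have h3 := scanPath_snd_forall (P := fun d => d ⊆ x :: c)
      (fun _ _ hs hp => fun a ha => hp (hs.subset ha)) hsub x
    rw [scanColumn, h1, scanColumn_eq_self c _ hx.2
      (scanPath_snd_forall (fun _ _ hs hp => hp.sublist hs.sublist) hcs x)]
    intro d hd y hy
    rcases List.mem_cons.1 (h3 d hd hy) with rfl | hy'
    · exact absurd (h2 d hd y hy) (lt_irrefl _)
    · exact hy'

/-- Row by row, the column `l` is at most the column `l'` (columns are listed upwards). -/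
def RowLE (l l' : List ℕ) : Prop :=
  ∀ x c y d, (x :: c) <:+ l → (y :: d) <:+ l' → c.length = d.length → x ≤ y

/-- The entry of the column `l` in row `k` is at most `f k`. -/
def BoundedBy (f : ℕ → ℕ) (l : List ℕ) : Prop :=
  ∀ x c, (x :: c) <:+ l → x ≤ f c.length

/-- The row of an entry is the number of entries after it in the list, so removing bottom values
does not change the rows of the others. -/
theorem RowLE.suffix {a b a' b' : List ℕ} (ha : a' <:+ a) (hb : b' <:+ b) (h : RowLE a b) :
    RowLE a' b' :=
  fun x c y d h1 h2 h3 => h x c y d (h1.trans ha) (h2.trans hb) h3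

theorem BoundedBy.suffix {f : ℕ → ℕ} {a a' : List ℕ} (ha : a' <:+ a) (h : BoundedBy f a) :
    BoundedBy f a' :=
  fun x c h1 => h x c (h1.trans ha)

theorem exists_cons_suffix {l : List ℕ} {k : ℕ} (hk : k < l.length) :
    ∃ x c, (x :: c) <:+ l ∧ c.length = k ∧ x ∈ l := by
  have h1 : l.length - 1 - k < l.length := by omega
  refine ⟨l[l.length - 1 - k], l.drop (l.length - 1 - k + 1), ?_, ?_, List.getElem_mem h1⟩
  · rw [← List.drop_eq_getElem_cons h1]
    exact List.drop_suffix _ _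
  · rw [List.length_drop]
    omega

/-- A scanning path that starts in row `m`, when all columns have at most `m + 1` unmarked values,
ends with a value in one of the rows `≤ m`, and leaves at most `m` unmarked values per column. -/
theorem scanPath_bound {f : ℕ → ℕ} (hf : Monotone f) (m : ℕ) : ∀ (cs : List (List ℕ)) (v : ℕ),
    (∀ l ∈ cs, l.length ≤ m + 1) → (∀ l ∈ cs, l.Pairwise (· > ·)) → cs.Pairwise RowLE →
    (∀ l ∈ cs, BoundedBy f l) → v ≤ f m →
    (∀ x c, (x :: c) ∈ cs → c.length = m → v ≤ x) →
    (scanPath v cs).1 ≤ f m ∧ ∀ l ∈ (scanPath v cs).2, l.length ≤ m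
  | [], v, _, _, _, _, hv, _ => ⟨hv, by simp [scanPath]⟩
  | [] :: cs, v, h1, h2, h3, h4, hv, h5 => by
    obtain ⟨i1, i2⟩ := scanPath_bound hf m cs v (fun l hl => h1 l (List.mem_cons_of_mem _ hl))
      (fun l hl => h2 l (List.mem_cons_of_mem _ hl)) (List.pairwise_cons.1 h3).2
      (fun l hl => h4 l (List.mem_cons_of_mem _ hl)) hv
      (fun x c hl => h5 x c (List.mem_cons_of_mem _ hl))
    refine ⟨i1, fun l hl => ?_⟩
    rcases List.mem_cons.1 hl with rfl | hl
    · simp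
    · exact i2 l hl
  | (z :: e) :: cs, v, h1, h2, h3, h4, hv, h5 => by
    have he : e.length ≤ m := by simpa using h1 _ List.mem_cons_self
    rw [scanPath]
    split_ifs with hz
    · obtain ⟨i1, i2⟩ := scanPath_bound hf m cs z (fun l hl => h1 l (List.mem_cons_of_mem _ hl))
        (fun l hl => h2 l (List.mem_cons_of_mem _ hl)) (List.pairwise_cons.1 h3).2
        (fun l hl => h4 l (List.mem_cons_of_mem _ hl))
        ((h4 _ List.mem_cons_self z e List.suffix_rfl).trans (hf he)) (by
          intro x c hc hlen
          -- The path now stands at `z`. A later column with `m + 1` unmarked values has an entry `y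
          -- ≥ z` in the row of `z`, and its bottom value is at least `y`; so the path will still
          -- take that bottom value.
          obtain ⟨y, d, hd, hdl, hy⟩ := exists_cons_suffix (l := x :: c) (k := e.length)
            (by simp; omega)
          have hzy : z ≤ y :=
            (List.pairwise_cons.1 h3).1 _ hc z e y d List.suffix_rfl hd hdl.symm
          rcases List.mem_cons.1 hy with rfl | hy
          · exact hzy
          · have := (List.pairwise_cons.1 (h2 _ (List.mem_cons_of_mem _ hc))).1 y hy
            omega)
      refine ⟨i1, fun l hl => ?_⟩
      rcases List.mem_cons.1 hl with rfl | hl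
      · exact he
      · exact i2 l hl
    · obtain ⟨i1, i2⟩ := scanPath_bound hf m cs v (fun l hl => h1 l (List.mem_cons_of_mem _ hl))
        (fun l hl => h2 l (List.mem_cons_of_mem _ hl)) (List.pairwise_cons.1 h3).2
        (fun l hl => h4 l (List.mem_cons_of_mem _ hl)) hv
        (fun x c hl => h5 x c (List.mem_cons_of_mem _ hl))
      refine ⟨i1, fun l hl => ?_⟩
      rcases List.mem_cons.1 hl with rfl | hl
      -- A column that is passed over cannot have had `m + 1` unmarked values.
      · have := mt (h5 z e List.mem_cons_self) hz
        simp only [List.length_cons]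
        omega
      · exact i2 l hl

theorem scanColumn_boundedBy {f : ℕ → ℕ} (hf : Monotone f) : ∀ (l : List ℕ) (cs : List (List ℕ)),
    (∀ c ∈ l :: cs, c.length ≤ l.length) → (∀ c ∈ l :: cs, c.Pairwise (· > ·)) →
    (l :: cs).Pairwise RowLE → (∀ c ∈ l :: cs, BoundedBy f c) → BoundedBy f (scanColumn l cs)
  | [], _, _, _, _, _ => by
    intro x c h
    simp [scanColumn] at h
  | z :: e, cs, h1, h2, h3, h4 => by
    have h3' := List.pairwise_cons.1 h3
    obtain ⟨i1, i2⟩ := scanPath_bound hf e.length cs z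
      (fun l hl => by simpa using h1 l (List.mem_cons_of_mem _ hl))
      (fun l hl => h2 l (List.mem_cons_of_mem _ hl)) h3'.2
      (fun l hl => h4 l (List.mem_cons_of_mem _ hl))
      (h4 _ List.mem_cons_self z e List.suffix_rfl)
      (fun x c hl hlen => h3'.1 _ hl z e x c List.suffix_rfl List.suffix_rfl hlen.symm)
    have hsuf := List.Forall₂.cons (List.suffix_cons z e) (scanPath_snd_suffix cs z)
    have key := scanColumn_boundedBy hf e (scanPath z cs).2 (by simpa using i2)
      (fun l hl => by
        obtain ⟨c, hc, hs⟩ := exists_mem_of_forall₂_suffix hsuf hl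
        exact (h2 c hc).sublist hs.sublist)
      (pairwise_of_forall₂_suffix (fun _ _ _ _ ha hb h => h.suffix ha hb) hsuf h3)
      (fun l hl => by
        obtain ⟨c, hc, hs⟩ := exists_mem_of_forall₂_suffix hsuf hl
        exact (h4 c hc).suffix hs)
    intro x c hx
    rw [scanColumn, List.suffix_cons_iff] at hx
    rcases hx with hx | hx
    · obtain ⟨rfl, rfl⟩ := List.cons.inj hx
      rw [length_scanColumn]
      exact i1
    · exact key x c hx

/-! ### Ranks -/

section Rank

variable {n : ℕ}

/-- Membership together with the number of larger elements pins down the rank, so the sorted list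
and the default value need not appear again. -/
theorem rankLargest_mem_and_card {d : ℕ} {Q : Finset (Fin n)} (h1 : 1 ≤ d) (h2 : d ≤ Q.card)
    (dflt : Fin n) : rankLargest d Q dflt ∈ Q ∧
      (Q.filter fun x => rankLargest d Q dflt < x).card = d - 1 := by
  have hlen : (Q.sort (· ≥ ·)).length = Q.card := Finset.length_sort _
  have hk : d - 1 < (Q.sort (· ≥ ·)).length := by omega
  have hs : (Q.sort (· ≥ ·)).Pairwise (· ≥ ·) := Finset.pairwise_sort _ _
  have hnd : (Q.sort (· ≥ ·)).Nodup := Finset.sort_nodup _ _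
  have hr : rankLargest d Q dflt = (Q.sort (· ≥ ·))[d - 1] := List.getD_eq_getElem _ _ hk
  have hmem : ∀ x, x ∈ Q.sort (· ≥ ·) ↔ x ∈ Q := fun x => Finset.mem_sort _
  rw [hr]
  generalize Q.sort (· ≥ ·) = L at *
  refine ⟨(hmem _).1 (List.getElem_mem hk), ?_⟩
  have : (Q.filter fun x => L[d - 1] < x) = (L.take (d - 1)).toFinset := by
    ext x
    simp only [Finset.mem_filter, List.mem_toFinset, List.mem_take_iff_getElem, ← hmem]
    constructor
    · rintro ⟨hx, hlt⟩
      obtain ⟨i, hi, rfl⟩ := List.mem_iff_getElem.1 hx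
      refine ⟨i, ?_, rfl⟩
      by_contra hcon
      rcases (show d - 1 ≤ i by omega).eq_or_lt with h | h
      · subst h
        exact lt_irrefl _ hlt
      · exact absurd (List.pairwise_iff_getElem.1 hs _ _ hk hi h) (not_le.2 hlt)
    · rintro ⟨i, hi, rfl⟩
      have hi' : i < d - 1 := by omega
      have hi2 : i < L.length := by omega
      refine ⟨List.getElem_mem hi2, lt_of_le_of_ne ?_ ?_⟩
      · exact List.pairwise_iff_getElem.1 hs _ _ hi2 hk hi'
      · intro he
        have := (hnd.getElem_inj_iff).1 he
        omega
  rw [this, List.toFinset_card_of_nodup (hnd.sublist (List.take_sublist _ _)), List.length_take]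
  omega

theorem rankLargest_eq_of_card {d : ℕ} {Q : Finset (Fin n)} (h1 : 1 ≤ d) (h2 : d ≤ Q.card)
    (dflt : Fin n) {z : Fin n} (hz : z ∈ Q) (hc : (Q.filter fun x => z < x).card = d - 1) :
    rankLargest d Q dflt = z := by
  obtain ⟨h3, h4⟩ := rankLargest_mem_and_card h1 h2 dflt
  generalize rankLargest d Q dflt = r at h3 h4
  have key : ∀ a b : Fin n, b ∈ Q → a < b →
      (Q.filter fun x => b < x).card < (Q.filter fun x => a < x).card := by
    intro a b hb hab
    apply Finset.card_lt_card
    rw [Finset.ssubset_iff_of_subset]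
    · exact ⟨b, by simp [hb, hab], by simp⟩
    · intro x hx
      simp only [Finset.mem_filter] at hx ⊢
      exact ⟨hx.1, hab.trans hx.2⟩
  rcases lt_trichotomy r z with h | h | h
  · have := key _ _ hz h
    omega
  · exact h
  · have := key _ _ h3 h
    omega

theorem card_filter_gt_add_le (Q : Finset (Fin n)) (y : Fin n) :
    (Q.filter fun x => y < x).card + (Q.filter fun x => x ≤ y).card = Q.card := by
  rw [← Finset.card_filter_add_card_filter_not (s := Q) (fun x => y < x)]
  simp only [not_lt]

/-- The `(q - i)`-th largest of `q` elements has exactly `i` elements below it. Entrywise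
comparisons of sorted columns thus become comparisons of counts. -/
theorem rankLargest_le_iff {q i : ℕ} {Q : Finset (Fin n)} (hq : Q.card = q) (hi : i < q)
    (dflt y : Fin n) :
    rankLargest (q - i) Q dflt ≤ y ↔ i < (Q.filter fun x => x ≤ y).card := by
  obtain ⟨h3, h4⟩ := rankLargest_mem_and_card (d := q - i) (Q := Q) (by omega) (by omega) dflt
  generalize rankLargest (q - i) Q dflt = r at h3 h4
  have h5 := card_filter_gt_add_le Q r
  constructor
  · intro h
    have : (Q.filter fun x => x ≤ r).card ≤ (Q.filter fun x => x ≤ y).card :=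
      Finset.card_le_card (Finset.monotone_filter_right _ fun x _ hx => hx.trans h)
    omega
  · intro h
    by_contra hlt
    rw [not_le] at hlt
    have : (Q.filter fun x => x ≤ y).card < (Q.filter fun x => x ≤ r).card := by
      apply Finset.card_lt_card
      rw [Finset.ssubset_iff_of_subset]
      · exact ⟨r, by simp [h3], by simp [hlt]⟩
      · exact Finset.monotone_filter_right _ fun x _ hx => hx.trans hlt.le
    omega

theorem rankLargest_strictMono {q i j : ℕ} {Q : Finset (Fin n)} (hq : Q.card = q) (hij : i < j)
    (hj : j < q) (a b : Fin n) : rankLargest (q - i) Q a < rankLargest (q - j) Q b := by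
  obtain ⟨h3, h4⟩ := rankLargest_mem_and_card (d := q - i) (Q := Q) (by omega) (by omega) a
  have h5 := card_filter_gt_add_le Q (rankLargest (q - i) Q a)
  by_contra h
  rw [not_lt, rankLargest_le_iff hq hj] at h
  omega

theorem rankLargest_mem {q i : ℕ} {Q : Finset (Fin n)} (hq : Q.card = q) (hi : i < q)
    (a : Fin n) : rankLargest (q - i) Q a ∈ Q :=
  (rankLargest_mem_and_card (by omega) (by omega) a).1

theorem card_filter_le_rankLargest {q i : ℕ} {Q : Finset (Fin n)} (hq : Q.card = q) (hi : i < q)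
    (a : Fin n) : (Q.filter fun x => x ≤ rankLargest (q - i) Q a).card = i + 1 := by
  have h1 := rankLargest_mem_and_card (d := q - i) (Q := Q) (by omega) (by omega) a
  have h2 := card_filter_gt_add_le Q (rankLargest (q - i) Q a)
  omega

theorem exists_rankLargest_eq {q : ℕ} {Q : Finset (Fin n)} (hq : Q.card = q) {v : Fin n}
    (hv : v ∈ Q) : ∃ i < q, ∀ a, rankLargest (q - i) Q a = v := by
  have h1 := card_filter_gt_add_le Q v
  have h2 : 0 < (Q.filter fun x => x ≤ v).card := Finset.card_pos.2 ⟨v, by simp [hv]⟩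
  refine ⟨(Q.filter fun x => x ≤ v).card - 1, by omega, fun a => ?_⟩
  exact rankLargest_eq_of_card (by omega) (by omega) a hv (by omega)

/-- The `i + 1` elements of `Q` up to this rank are distinct values in an initial segment of `Fin
n`. -/
theorem le_rankLargest {q : ℕ} {Q : Finset (Fin n)} (hq : Q.card = q) {i : Fin n}
    (hi : (i : ℕ) < q) (a : Fin n) : i ≤ rankLargest (q - i) Q a := by
  have h := card_filter_le_rankLargest hq hi a
  have h2 : (Q.filter fun x => x ≤ rankLargest (q - i) Q a).card ≤
      (Finset.Iic (rankLargest (q - i) Q a)).card :=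
    Finset.card_le_card fun x hx => by simpa using (Finset.mem_filter.1 hx).2
  rw [Fin.card_Iic] at h2
  exact Fin.le_def.2 (by omega)

theorem card_filter_lt {m : ℕ} (hm : m ≤ n) :
    (Finset.univ.filter fun k : Fin n => (k : ℕ) < m).card = m := by
  rw [Fin.card_filter_val_lt]
  omega

theorem mem_firstEntries {π : Fin n → Fin n} {m : ℕ} {v : Fin n} :
    v ∈ firstEntries π m ↔ ∃ k : Fin n, (k : ℕ) < m ∧ π k = v := by
  simp [firstEntries]

theorem card_firstEntries {π : Fin n → Fin n} (hπ : Function.Injective π) {m : ℕ} (hm : m ≤ n) :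
    (firstEntries π m).card = m := by
  rw [firstEntries, Finset.card_image_of_injective _ hπ, card_filter_lt hm]

theorem firstEntries_mono (π : Fin n → Fin n) {m m' : ℕ} (h : m ≤ m') :
    firstEntries π m ⊆ firstEntries π m' := by
  intro v hv
  obtain ⟨k, hk, rfl⟩ := mem_firstEntries.1 hv
  exact mem_firstEntries.2 ⟨k, by omega, rfl⟩

end Rank

/-! ### Carrels -/

section Carrel

variable {n : ℕ} {R : Finset ℕ}

theorem SameCarrel.symm {i j : Fin n} (h : SameCarrel R i j) : SameCarrel R j i :=
  fun q hq => (h q hq).symm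

theorem SameCarrel.trans {i j k : Fin n} (h : SameCarrel R i j) (h' : SameCarrel R j k) :
    SameCarrel R i k :=
  fun q hq => (h q hq).trans (h' q hq)

theorem SameCarrel.refl (i : Fin n) : SameCarrel R i i := fun _ _ => Iff.rfl

theorem SameCarrel.of_le_of_le {i j k : Fin n} (h : SameCarrel R i k) (hij : i ≤ j)
    (hjk : j ≤ k) : SameCarrel R i j := by
  intro q hq
  have := h q hq
  rw [Fin.le_def] at hij hjk
  constructor <;> intro h'
  · omega
  · exact this.2 (by omega)

theorem mem_carrel {i j : Fin n} : j ∈ carrel R i ↔ SameCarrel R i j := by simp [carrel]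

theorem sameCarrel_carrelLast (i : Fin n) : SameCarrel R i (carrelLast R i) :=
  mem_carrel.1 (Finset.max'_mem _ (carrel_nonempty R i))

theorem sameCarrel_carrelFirst (i : Fin n) : SameCarrel R i (carrelFirst R i) :=
  mem_carrel.1 (Finset.min'_mem _ (carrel_nonempty R i))

theorem SameCarrel.le_carrelLast {i j : Fin n} (h : SameCarrel R i j) : j ≤ carrelLast R i :=
  Finset.le_max' _ _ (mem_carrel.2 h)

theorem SameCarrel.carrelFirst_le {i j : Fin n} (h : SameCarrel R i j) : carrelFirst R i ≤ j :=
  Finset.min'_le _ _ (mem_carrel.2 h)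

theorem le_carrelLast (i : Fin n) : i ≤ carrelLast R i := (SameCarrel.refl i).le_carrelLast

theorem carrelFirst_le (i : Fin n) : carrelFirst R i ≤ i := (SameCarrel.refl i).carrelFirst_le

theorem SameCarrel.carrelLast_eq {i j : Fin n} (h : SameCarrel R i j) :
    carrelLast R i = carrelLast R j :=
  le_antisymm (h.symm.trans (sameCarrel_carrelLast i)).le_carrelLast
    (h.trans (sameCarrel_carrelLast j)).le_carrelLast

theorem SameCarrel.carrelFirst_eq {i j : Fin n} (h : SameCarrel R i j) :
    carrelFirst R i = carrelFirst R j :=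
  le_antisymm (h.trans (sameCarrel_carrelFirst j)).carrelFirst_le
    (h.symm.trans (sameCarrel_carrelFirst i)).carrelFirst_le

theorem sameCarrel_of_between {i j : Fin n} (h1 : carrelFirst R i ≤ j) (h2 : j ≤ carrelLast R i) :
    SameCarrel R i j := by
  have h : SameCarrel R (carrelFirst R i) (carrelLast R i) :=
    (sameCarrel_carrelFirst i).symm.trans (sameCarrel_carrelLast i)
  exact (sameCarrel_carrelFirst i).trans (h.of_le_of_le h1 h2)

/-- Right ends of carrels. -/
def IsEnd (n : ℕ) (R : Finset ℕ) (q : ℕ) : Prop := q ∈ R ∨ q = n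

theorem isEnd_carrelLast (i : Fin n) : IsEnd n R (carrelLast R i + 1) := by
  by_cases h : (carrelLast R i : ℕ) + 1 < n
  · left
    have h1 : ¬ SameCarrel R (carrelLast R i) ⟨carrelLast R i + 1, h⟩ := by
      intro hs
      have := ((sameCarrel_carrelLast i).trans hs).le_carrelLast
      rw [Fin.le_def] at this
      simp at this
    simp only [SameCarrel, not_forall] at h1
    obtain ⟨q, hq, h2⟩ := h1
    have : q = carrelLast R i + 1 := by omega
    rwa [← this]
  · right
    have := (carrelLast R i).isLt
    omega

theorem SameCarrel.lt_iff {i j : Fin n} (h : SameCarrel R i j) {q : ℕ} (hq : IsEnd n R q) :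
    (i : ℕ) < q ↔ (j : ℕ) < q := by
  rcases hq with hq | rfl
  · have := h q hq
    omega
  · simp

theorem carrelLast_lt_of_isEnd {i : Fin n} {q : ℕ} (hq : IsEnd n R q) (h : (i : ℕ) < q) :
    (carrelLast R i : ℕ) < q :=
  ((sameCarrel_carrelLast i).lt_iff hq).1 h

theorem le_carrelFirst_of_mem {i : Fin n} {q : ℕ} (hq : q ∈ R) (h : q ≤ i) :
    q ≤ carrelFirst R i :=
  (sameCarrel_carrelFirst i q hq).1 h

theorem IsRIncreasing.add_sub_le {γ : Fin n → Fin n} (hγ : IsRIncreasing R γ) {i j : Fin n}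
    (hij : i ≤ j) (h : SameCarrel R i j) : (γ i : ℕ) + j ≤ γ j + i := by
  obtain ⟨d, hd⟩ : ∃ d, (j : ℕ) = i + d := ⟨j - i, by rw [Fin.le_def] at hij; omega⟩
  induction d generalizing j with
  | zero =>
    obtain rfl : i = j := Fin.ext (by omega)
    exact le_rfl
  | succ d ih =>
    have hlt : (i : ℕ) + d < n := by have := j.isLt; omega
    have h1 : i ≤ (⟨i + d, hlt⟩ : Fin n) := Fin.le_def.2 (by simp)
    have h2 : (⟨i + d, hlt⟩ : Fin n) < j := Fin.lt_def.2 (by simp; omega)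
    have h3 := h.of_le_of_le h1 h2.le
    have h4 := ih h1 h3 rfl
    have h5 := Fin.lt_def.1 (hγ _ _ h2 (h3.symm.trans h))
    simp only at h4
    omega

end Carrel

/-! ### Critical indices and cores -/

section Core

variable {n : ℕ} {R : Finset ℕ} {υ η γ : Fin n → Fin n}

/-- Read from right to left in a carrel, critical indices are the strict record minima of `υ x - x`.
The inequality is written additively to avoid truncated subtraction. -/
theorem IsCritical.lt_of_lt {x : Fin n} (h : IsCritical R υ x) :
    ∀ z, x < z → SameCarrel R x z → (υ x : ℕ) + z < υ z + x := by
  induction h with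
  | last x hx =>
    intro z hz hs
    have := hs.le_carrelLast
    rw [hx] at this
    exact absurd hz (not_lt.2 this)
  | next x y _ hyx hs h1 h2 ih =>
    intro z hz hsz
    rcases lt_trichotomy z x with h | h | h
    · have := h2 z hz h
      omega
    · subst h
      exact h1
    · have := ih z h (hs.symm.trans hsz)
      omega

/-- `x` is the nearest critical index at or to the right of `i`: it is the last place where
`υ_x - x` is minimal among the indices from `i` on in the carrel of `i`. -/
structure IsNextCritical (R : Finset ℕ) (υ : Fin n → Fin n) (i x : Fin n) : Prop where
  le : i ≤ x
  same : SameCarrel R i x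
  min : ∀ z, i ≤ z → z ≤ x → (υ x : ℕ) + z ≤ υ z + x
  lt : ∀ z, x < z → SameCarrel R i z → (υ x : ℕ) + z < υ z + x

theorem isNextCritical_nextCritical (i : Fin n) : IsNextCritical R υ i (nextCritical R υ i) := by
  have h0 := Finset.min'_mem _ (criticalFrom_nonempty R υ i)
  have hmin : ∀ z, i ≤ z → IsCritical R υ z → nextCritical R υ i ≤ z := fun z h1 h2 =>
    Finset.min'_le _ _ (by simp [criticalFrom, h1, h2])
  change nextCritical R υ i ∈ _ at h0
  generalize nextCritical R υ i = x at h0 hmin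
  simp only [criticalFrom, Finset.mem_filter, Finset.mem_univ, true_and] at h0
  obtain ⟨h1, h2⟩ := h0
  have hl : x ≤ carrelLast R i := hmin _ (le_carrelLast i)
    (IsCritical.last _ (sameCarrel_carrelLast i).symm.carrelLast_eq)
  have hs : SameCarrel R i x := (sameCarrel_carrelLast i).of_le_of_le h1 hl
  refine ⟨h1, hs, ?_, fun z hz hsz => h2.lt_of_lt z hz (hs.symm.trans hsz)⟩
  by_contra! hcon
  obtain ⟨z, hz1, hz2, hz3⟩ := hcon
  -- The largest violating index would be the next critical index to the left of `x`, contradicting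
  -- the choice of `x` as the first one from `i` on.
  let S := Finset.univ.filter fun z : Fin n => i ≤ z ∧ z ≤ x ∧ (υ z : ℕ) + x < υ x + z
  have hS : S.Nonempty := ⟨z, by simp [S, hz1, hz2, hz3]⟩
  have hm := Finset.max'_mem S hS
  have hM : ∀ w ∈ S, w ≤ S.max' hS := fun w hw => Finset.le_max' _ _ hw
  generalize S.max' hS = y at hm hM
  simp only [S, Finset.mem_filter, Finset.mem_univ, true_and] at hm hM
  obtain ⟨h4, h5, h6⟩ := hm
  have hyx : y < x := lt_of_le_of_ne h5 (by rintro rfl; omega)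
  have := hmin y h4 (IsCritical.next x y h2 hyx ((hs.of_le_of_le h4 h5).symm.trans hs) h6
    fun w hw1 hw2 hw3 => absurd (hM w ⟨h4.trans hw1.le, hw2.le, hw3⟩) (not_le.2 hw1))
  exact absurd hyx (not_lt.2 this)

theorem IsNextCritical.unique {i x y : Fin n} (hx : IsNextCritical R υ i x)
    (hy : IsNextCritical R υ i y) : x = y := by
  rcases lt_trichotomy x y with h | h | h
  · have h1 := hx.lt y h hy.same
    have h2 := hy.min x hx.le h.le
    omega
  · exact h
  · have h1 := hy.lt x h hx.same
    have h2 := hx.min y hy.le h.le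
    omega

theorem IsNextCritical.nextCritical_eq {i x : Fin n} (hx : IsNextCritical R υ i x) :
    nextCritical R υ i = x :=
  (isNextCritical_nextCritical i).unique hx

/-- All indices from `i` to `x` share the critical index `x`; hence on this interval the core runs
through consecutive values and the ceiling is constant. -/
theorem IsNextCritical.of_between {i x j : Fin n} (hx : IsNextCritical R υ i x) (h1 : i ≤ j)
    (h2 : j ≤ x) : IsNextCritical R υ j x :=
  have hs := hx.same.of_le_of_le h1 h2
  ⟨h2, hs.symm.trans hx.same, fun z hz => hx.min z (h1.trans hz),
    fun z hz hsz => hx.lt z hz (hs.trans hsz)⟩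

theorem IsNextCritical.core_add (hυ : IsUpper υ) {i x : Fin n} (hx : IsNextCritical R υ i x) :
    (core R υ i : ℕ) + x = υ x + i := by
  have h1 := Fin.le_def.1 hx.le
  have h2 := Fin.le_def.1 (hυ x)
  simp only [core, hx.nextCritical_eq]
  omega

theorem core_le (hυ : IsUpper υ) (i : Fin n) : core R υ i ≤ υ i := by
  have hx := isNextCritical_nextCritical (R := R) (υ := υ) i
  have h1 := hx.core_add hυ
  have h2 := hx.min i le_rfl hx.le
  exact Fin.le_def.2 (by omega)

theorem isUpper_core (hυ : IsUpper υ) : IsUpper (core R υ) := by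
  intro i
  have hx := isNextCritical_nextCritical (R := R) (υ := υ) i
  have h1 := hx.core_add hυ
  have h2 := Fin.le_def.1 (hυ (nextCritical R υ i))
  exact Fin.le_def.2 (by omega)

theorem isRIncreasing_core (hυ : IsUpper υ) : IsRIncreasing R (core R υ) := by
  intro i j hij hs
  have hx := isNextCritical_nextCritical (R := R) (υ := υ) i
  have hy := isNextCritical_nextCritical (R := R) (υ := υ) j
  have h1 := hx.core_add hυ
  rcases le_or_gt j (nextCritical R υ i) with h | h
  · have h2 := (hx.of_between hij.le h).core_add hυ
    rw [Fin.lt_def] at hij ⊢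
    omega
  · have h2 := hy.core_add hυ
    have h3 := hx.lt _ (h.trans_le hy.le) (hs.trans hy.same)
    rw [Fin.lt_def] at hij ⊢
    omega

theorem core_eq_self (hγ : IsUpper γ) (hi : IsRIncreasing R γ) : core R γ = γ := by
  funext i
  have hx := isNextCritical_nextCritical (R := R) (υ := γ) i
  have h1 := hx.core_add hγ
  have h2 := hx.min i le_rfl hx.le
  have h3 := hi.add_sub_le hx.le hx.same
  exact Fin.ext (by omega)

/-- The entry of `υ` at the nearest critical index at or to the right of `i`. -/
noncomputable def ceiling (R : Finset ℕ) (υ : Fin n → Fin n) (i : Fin n) : Fin n :=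
  υ (nextCritical R υ i)

theorem IsNextCritical.ceiling_eq {i x : Fin n} (hx : IsNextCritical R υ i x) :
    ceiling R υ i = υ x := by
  rw [ceiling, hx.nextCritical_eq]

/-- Raising entries up to the value at their critical index moves no critical index, so the ceiling
has the same core. -/
theorem IsNextCritical.ceiling {i x : Fin n} (hx : IsNextCritical R υ i x) :
    IsNextCritical R (ceiling R υ) i x := by
  have hxx := (hx.of_between hx.le le_rfl).ceiling_eq
  refine ⟨hx.le, hx.same, fun z h1 h2 => ?_, fun z h1 h2 => ?_⟩
  · rw [hxx, (hx.of_between h1 h2).ceiling_eq]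
    rw [Fin.le_def] at h2
    omega
  · have hz := isNextCritical_nextCritical (R := R) (υ := υ) z
    have h3 := hx.lt _ (h1.trans_le hz.le) (h2.trans hz.same)
    have h4 := Fin.le_def.1 hz.le
    rw [hxx, hz.ceiling_eq]
    omega

theorem isUpper_ceiling (hυ : IsUpper υ) : IsUpper (ceiling R υ) := fun i =>
  (isNextCritical_nextCritical i).le.trans (hυ _)

theorem core_ceiling (hυ : IsUpper υ) : core R (ceiling R υ) = core R υ := by
  funext i
  have hx := isNextCritical_nextCritical (R := R) (υ := υ) i
  have h1 := hx.core_add hυ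
  have h2 := hx.ceiling.core_add (isUpper_ceiling hυ)
  rw [(hx.of_between hx.le le_rfl).ceiling_eq] at h2
  exact Fin.ext (by omega)

theorem ceiling_le_of_sameCarrel {i j : Fin n} (hij : i ≤ j) (hs : SameCarrel R i j) :
    ceiling R υ i ≤ ceiling R υ j := by
  have hx := isNextCritical_nextCritical (R := R) (υ := υ) i
  have hy := isNextCritical_nextCritical (R := R) (υ := υ) j
  rcases le_or_gt j (nextCritical R υ i) with h | h
  · rw [hx.ceiling_eq, (hx.of_between hij h).ceiling_eq]
  · have h3 := hx.lt _ (h.trans_le hy.le) (hs.trans hy.same)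
    have h4 := Fin.lt_def.1 (h.trans_le hy.le)
    rw [hx.ceiling_eq, hy.ceiling_eq, Fin.le_def]
    omega

/-- Inside a carrel the values at critical indices increase. Across a divider, the last index of the
left carrel is its own critical index, and the needed inequality is exactly the gapless condition.
-/
theorem isUpperFlag_ceiling (hυ : IsGaplessCore R υ) : IsUpperFlag (ceiling R υ) := by
  refine ⟨isUpper_ceiling hυ.1, ?_⟩
  have step : ∀ e f : Fin n, (e : ℕ) + 1 = f → ceiling R υ e ≤ ceiling R υ f := by
    intro e f hef
    by_cases hs : SameCarrel R e f
    · exact ceiling_le_of_sameCarrel (Fin.le_def.2 (by omega)) hs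
    · have hx := isNextCritical_nextCritical (R := R) (υ := υ) e
      have : nextCritical R υ e = e := by
        by_contra hne
        have h1 := lt_of_le_of_ne hx.le (Ne.symm hne)
        exact hs (hx.same.of_le_of_le (Fin.le_def.2 (by omega))
          (Fin.le_def.2 (by rw [Fin.lt_def] at h1; omega)))
      rw [ceiling, this]
      exact hυ.2 e f hef hs
  intro i j hij
  obtain ⟨d, hd⟩ : ∃ d, (j : ℕ) = i + d := ⟨j - i, by rw [Fin.le_def] at hij; omega⟩
  induction d generalizing j with
  | zero =>
    obtain rfl : i = j := Fin.ext (by omega)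
    exact le_rfl
  | succ d ih =>
    have hlt : (i : ℕ) + d < n := by have := j.isLt; omega
    exact (ih (j := ⟨i + d, hlt⟩) (Fin.le_def.2 (by simp)) rfl).trans
      (step _ _ (by simp; omega))

theorem IsUpperFlag.isGaplessCore (h : IsUpperFlag υ) : IsGaplessCore R υ :=
  ⟨h.1, fun _ f hef _ => h.2 ((Fin.le_def.2 (by omega : _ ≤ (f : ℕ))).trans
    (isNextCritical_nextCritical f).le)⟩

/-- After a divider, an `R`-increasing tuple runs through consecutive values until it reaches the
value just before the divider. -/
def HasRuns (R : Finset ℕ) (γ : Fin n → Fin n) : Prop :=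
  ∀ e f k : Fin n, (e : ℕ) + 1 = f → ¬ SameCarrel R e f → SameCarrel R f k → γ k < γ e →
    ∃ k' : Fin n, (k' : ℕ) = k + 1 ∧ SameCarrel R f k' ∧ (γ k' : ℕ) = γ k + 1

/-- From `f` to its first critical index `x` the core climbs by ones, reaching `η x ≥ η e`, which is
at least the core at `e`. A smaller core value can thus occur only before `x`, inside the run. -/
theorem hasRuns_core (hη : IsGaplessCore R η) : HasRuns R (core R η) := by
  intro e f k hef hn hfk hlt
  have hx := isNextCritical_nextCritical (R := R) (υ := η) f
  have h1 := hη.2 e f hef hn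
  have h2 := core_le (R := R) hη.1 e
  generalize nextCritical R η f = x at hx h1
  have h3 := hx.core_add hη.1
  have h4 := (hx.of_between hx.le le_rfl).core_add hη.1
  have hfk' : f ≤ k := by
    by_contra hcon
    rw [Fin.le_def, not_le] at hcon
    exact hn (hfk.symm.of_le_of_le (Fin.le_def.2 (by omega)) (Fin.le_def.2 (by omega))
      |>.symm.trans hfk.symm)
  have hkx : k < x := by
    by_contra hcon
    rw [not_lt] at hcon
    have h5 := (isRIncreasing_core (R := R) hη.1).add_sub_le hcon (hx.same.symm.trans hfk)
    rw [Fin.le_def] at *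
    rw [Fin.lt_def] at hlt
    omega
  have hkx' := Fin.lt_def.1 hkx
  have hlt : (k : ℕ) + 1 < n := by have := x.isLt; omega
  have h6 : k ≤ (⟨k + 1, hlt⟩ : Fin n) := Fin.le_def.2 (by simp)
  have h7 : (⟨k + 1, hlt⟩ : Fin n) ≤ x := Fin.le_def.2 (by simp; omega)
  refine ⟨⟨k + 1, hlt⟩, rfl, hx.same.of_le_of_le (hfk'.trans h6) h7, ?_⟩
  have h8 := (hx.of_between (hfk'.trans h6) h7).core_add hη.1
  have h9 := (hx.of_between hfk' hkx.le).core_add hη.1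
  simp only at h8
  omega

/-- If the value at the first critical index were too small, the run would go on with step one,
whereas after a critical index `γ z - z` is strictly larger. -/
theorem HasRuns.isGapless (hγ : IsUpper γ) (hi : IsRIncreasing R γ) (hr : HasRuns R γ) :
    IsGapless R γ := by
  refine ⟨⟨hγ, fun e f hef hn => ?_⟩, hi⟩
  have hx := isNextCritical_nextCritical (R := R) (υ := γ) f
  generalize nextCritical R γ f = x at hx
  by_contra hcon
  obtain ⟨k', h1, h2, h3⟩ := hr e f x hef hn hx.same (not_le.1 hcon)
  have := hx.lt k' (Fin.lt_def.2 (by omega)) h2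
  omega

end Core

/-! ### Rank tuples of 312-avoiding permutations -/

section RankTuple

variable {n : ℕ} {R : Finset ℕ} {π : Fin n → Fin n}

theorem rankTuple_eq {i l : Fin n} (h : carrelLast R i = l) :
    rankTuple R π i = rankLargest ((l : ℕ) + 1 - i) (firstEntries π ((l : ℕ) + 1)) i := by
  subst h
  rfl

theorem isUpper_rankTuple (hπ : Function.Injective π) : IsUpper (rankTuple R π) := fun i =>
  le_rankLargest (card_firstEntries hπ (carrelLast R i).isLt)
    (Nat.lt_succ_of_le (Fin.le_def.1 (le_carrelLast i))) i

theorem isRIncreasing_rankTuple (hπ : Function.Injective π) :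
    IsRIncreasing R (rankTuple R π) := by
  intro i j hij hs
  rw [rankTuple_eq hs.carrelLast_eq, rankTuple_eq rfl]
  exact rankLargest_strictMono (card_firstEntries hπ (carrelLast R j).isLt) (Fin.lt_def.1 hij)
    (Nat.lt_succ_of_le (Fin.le_def.1 (le_carrelLast j))) _ _

theorem card_filter_le_lt_of_mem {Q : Finset (Fin n)} {w v : Fin n} (hwv : w < v) (hv : v ∈ Q) :
    (Q.filter fun x => x ≤ w).card < (Q.filter fun x => x ≤ v).card := by
  apply Finset.card_lt_card
  rw [Finset.ssubset_iff_of_subset]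
  · exact ⟨v, by simp [hv], by simp [hwv]⟩
  · exact Finset.monotone_filter_right _ fun x _ hx => hx.trans hwv.le

theorem carrelLast_eq_of_not_sameCarrel {e f : Fin n} (hef : (e : ℕ) + 1 = f)
    (hn : ¬ SameCarrel R e f) : carrelLast R e = e := by
  by_contra hne
  have h1 := Fin.lt_def.1 (lt_of_le_of_ne (le_carrelLast (R := R) e) (Ne.symm hne))
  exact hn ((sameCarrel_carrelLast e).of_le_of_le (Fin.le_def.2 (by omega))
    (Fin.le_def.2 (by omega)))

theorem carrelFirst_eq_of_not_sameCarrel {e f : Fin n} (hef : (e : ℕ) + 1 = f)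
    (hn : ¬ SameCarrel R e f) : carrelFirst R f = f := by
  by_contra hne
  have h1 := Fin.lt_def.1 (lt_of_le_of_ne (carrelFirst_le (R := R) f) hne)
  exact hn ((sameCarrel_carrelFirst f).symm.of_le_of_le (Fin.le_def.2 (by omega))
    (Fin.le_def.2 (by omega)) |>.symm.trans (sameCarrel_carrelFirst f).symm)

theorem IsR312Avoiding.hasRuns_rankTuple (hπ : IsR312Avoiding R π) :
    HasRuns R (rankTuple R π) := by
  intro e f k hef hn hfk hlt
  have hinj := hπ.1.1
  have hle : carrelLast R e = e := carrelLast_eq_of_not_sameCarrel hef hn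
  have hff : carrelFirst R f = f := carrelFirst_eq_of_not_sameCarrel hef hn
  have hfk' : (f : ℕ) ≤ k := Fin.le_def.1 (hff ▸ hfk.carrelFirst_le)
  have hkl : (k : ℕ) ≤ carrelLast R f := Fin.le_def.1 hfk.le_carrelLast
  have hEnd := isEnd_carrelLast (R := R) f
  have hl : (carrelLast R f : ℕ) + 1 ≤ n := (carrelLast R f).isLt
  have hre := rankTuple_eq (π := π) hle
  have hrk := rankTuple_eq (π := π) hfk.carrelLast_eq.symm
  have hBe : (firstEntries π ((e : ℕ) + 1)).card = e + 1 := card_firstEntries hinj e.isLt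
  have hB : (firstEntries π ((carrelLast R f : ℕ) + 1)).card = carrelLast R f + 1 :=
    card_firstEntries hinj hl
  have hge : rankTuple R π e ∈ firstEntries π ((e : ℕ) + 1) := by
    rw [hre]
    exact rankLargest_mem hBe (by omega) _
  have hcard := card_filter_le_rankLargest hB (show (k : ℕ) < carrelLast R f + 1 by omega) k
  rw [← hrk] at hcard
  have hge' := firstEntries_mono π (show (e : ℕ) + 1 ≤ carrelLast R f + 1 by omega) hge
  -- The entry at `e` is a larger element of the same set, so the entry at `k` is not the maximum
  -- and `k + 1` still lies in the carrel.
  have hc2 := card_filter_le_lt_of_mem hlt hge'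
  have hc3 := Finset.card_filter_le (firstEntries π ((carrelLast R f : ℕ) + 1))
    (fun x => x ≤ rankTuple R π e)
  have hlt' := Fin.lt_def.1 hlt
  have hk1 : (k : ℕ) + 1 < n := by omega
  have hv1 : (rankTuple R π k : ℕ) + 1 < n := by have := (rankTuple R π e).isLt; omega
  have hsame : SameCarrel R f ⟨k + 1, hk1⟩ := by
    apply sameCarrel_of_between
    · rw [hff]
      exact Fin.le_def.2 (by simp; omega)
    · exact Fin.le_def.2 (by simp; omega)
  -- If the next value were missing, it would be placed at some `c` after the carrel. With `a` the
  -- position of the larger value `rankTuple R π e`, and `b` in the carrel carrying a value at most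
  -- `rankTuple R π k`, this is a 312 pattern. Such a `b` exists because `k + 1` entries are that
  -- small and only `e + 1 ≤ k` positions precede the carrel.
  have hvB : (⟨rankTuple R π k + 1, hv1⟩ : Fin n) ∈
      firstEntries π ((carrelLast R f : ℕ) + 1) := by
    by_contra hvB
    apply hπ.2
    obtain ⟨c, hc⟩ := Finite.surjective_of_injective hinj ⟨rankTuple R π k + 1, hv1⟩
    have hcl : (carrelLast R f : ℕ) + 1 ≤ c := by
      by_contra hcon
      exact hvB (mem_firstEntries.2 ⟨c, by omega, hc⟩)
    obtain ⟨a, ha, hae⟩ := mem_firstEntries.1 hge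
    have hb : ∃ b : Fin n, (e : ℕ) + 1 ≤ b ∧ (b : ℕ) < carrelLast R f + 1 ∧
        π b ≤ rankTuple R π k := by
      by_contra! hcon
      have : ((firstEntries π ((carrelLast R f : ℕ) + 1)).filter
          fun x => x ≤ rankTuple R π k) ⊆ firstEntries π ((e : ℕ) + 1) := by
        intro x hx
        obtain ⟨hx1, hx2⟩ := Finset.mem_filter.1 hx
        obtain ⟨b, hb, rfl⟩ := mem_firstEntries.1 hx1
        refine mem_firstEntries.2 ⟨b, ?_, rfl⟩
        by_contra h
        exact absurd hx2 (not_le.2 (hcon b (by omega) hb))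
      have := Finset.card_le_card this
      omega
    obtain ⟨b, hb1, hb2, hb3⟩ := hb
    have hR1 : (e : ℕ) + 1 ∈ R := by
      have := isEnd_carrelLast (R := R) e
      rw [hle] at this
      rcases this with h | h
      · exact h
      · have := f.isLt
        omega
    have hR2 : (carrelLast R f : ℕ) + 1 ∈ R := by
      rcases hEnd with h | h
      · exact h
      · have := c.isLt
        omega
    have hne : rankTuple R π e ≠ ⟨rankTuple R π k + 1, hv1⟩ := fun h => hvB (h ▸ hge')
    have hne' : (rankTuple R π e : ℕ) ≠ rankTuple R π k + 1 := fun h => hne (Fin.ext h)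
    rw [Fin.le_def] at hb3
    refine ⟨_, hR1, _, hR2, a, b, c, ha, hb1, hb2, hcl, ?_, ?_, ?_⟩
    · rw [hae, Fin.lt_def]
      omega
    · rw [hc, Fin.lt_def]
      simp only
      omega
    · rw [hc, hae, Fin.lt_def]
      simp only
      omega
  refine ⟨⟨k + 1, hk1⟩, rfl, hsame, ?_⟩
  have h1 := isRIncreasing_rankTuple (R := R) hinj k ⟨k + 1, hk1⟩ (Fin.lt_def.2 (by simp))
    (hfk.symm.trans hsame)
  have h2 : rankTuple R π ⟨k + 1, hk1⟩ ≤ ⟨rankTuple R π k + 1, hv1⟩ := by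
    rw [rankTuple_eq hsame.carrelLast_eq.symm, rankLargest_le_iff hB (by simp only; omega)]
    have := card_filter_le_lt_of_mem (w := rankTuple R π k) (Fin.lt_def.2 (by simp)) hvB
    simp only
    omega
  rw [Fin.lt_def] at h1
  rw [Fin.le_def] at h2
  simp only at h2
  omega

theorem IsR312Avoiding.isGapless_rankTuple (hπ : IsR312Avoiding R π) :
    IsGapless R (rankTuple R π) :=
  hπ.hasRuns_rankTuple.isGapless (isUpper_rankTuple hπ.1.1) (isRIncreasing_rankTuple hπ.1.1)

/-- For a 312-avoiding permutation, a strictly increasing column that is bounded by the rank tuple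
is bounded by the corresponding column of the key. -/
theorem IsR312Avoiding.le_rankLargest (hπ : IsR312Avoiding R π) {q : ℕ} (hq : IsEnd n R q)
    (hqn : q ≤ n) {t : ℕ → ℕ} (ht : ∀ i, i + 1 < q → t i < t (i + 1))
    (hb : ∀ i : Fin n, (i : ℕ) < q → t i ≤ rankTuple R π i) (i : Fin n) (hi : (i : ℕ) < q) :
    t i ≤ rankLargest (q - i) (firstEntries π q) i := by
  have hinj := hπ.1.1
  have hB := card_firstEntries hinj hqn
  -- Descending induction on the row: in the bottom row `q - 1` the rank tuple and the key column
  -- use the same set of entries.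
  obtain ⟨d, hd⟩ : ∃ d, (i : ℕ) + 1 + d = q := ⟨q - (i + 1), by omega⟩
  induction d generalizing i with
  | zero =>
    have hl : (carrelLast R i : ℕ) + 1 = q := by
      have h1 := carrelLast_lt_of_isEnd hq hi
      have h2 := Fin.le_def.1 (le_carrelLast (R := R) i)
      omega
    have := hb i hi
    rwa [rankTuple_eq rfl, hl] at this
  | succ d ih =>
    have hi1 : (i : ℕ) + 1 < n := by omega
    have ih' := ih ⟨i + 1, hi1⟩ (by simp only; omega) (by simp only; omega)
    have hstep := ht i (by omega)
    have hcard := card_filter_le_rankLargest hB hi i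
    have hinc := rankLargest_strictMono hB (Nat.lt_succ_self i)
      (show (i : ℕ) + 1 < q by omega) i ⟨i + 1, hi1⟩
    simp only [Nat.succ_eq_add_one] at ih' hinc
    generalize hw : rankLargest (q - i) (firstEntries π q) i = w at *
    have hv1 : (w : ℕ) + 1 < n :=
      lt_of_le_of_lt (Fin.lt_def.1 hinc) (Fin.isLt _)
    -- If `w + 1` is present, the next key entry is `w + 1` and strictness of `t` gives the bound.
    -- If it is absent, 312-avoidance forces the rank tuple itself to be at most `w`.
    by_cases hv : (⟨w + 1, hv1⟩ : Fin n) ∈ firstEntries π q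
    · have h2 : rankLargest (q - (i + 1)) (firstEntries π q) (⟨i + 1, hi1⟩ : Fin n) ≤
          ⟨w + 1, hv1⟩ := by
        rw [rankLargest_le_iff hB (by omega)]
        have := card_filter_le_lt_of_mem (w := w) (Fin.lt_def.2 (by simp)) hv
        omega
      rw [Fin.le_def] at h2
      simp only at h2
      omega
    · have hle : rankTuple R π i ≤ w := by
        have hli := Fin.le_def.1 (le_carrelLast (R := R) i)
        have hlq := carrelLast_lt_of_isEnd hq hi
        have hBi := card_firstEntries hinj (m := (carrelLast R i : ℕ) + 1) (carrelLast R i).isLt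
        rw [rankTuple_eq rfl, rankLargest_le_iff hBi (by omega)]
        -- At most `i` entries up to the end of the carrel are at most `w`, but `i + 1` of the first
        -- `q` entries are. This puts some `b` after the carrel with `π b ≤ w`, while some `a` no
        -- later than its end has `π a > w`; the value `w + 1`, placed after `q`, completes a 312
        -- pattern.
        by_contra hcon
        apply hπ.2
        have hb : ∃ b : Fin n, (carrelLast R i : ℕ) + 1 ≤ b ∧ (b : ℕ) < q ∧ π b ≤ w := by
          by_contra! hb
          have : ((firstEntries π q).filter fun x => x ≤ w) ⊆
              (firstEntries π ((carrelLast R i : ℕ) + 1)).filter fun x => x ≤ w := by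
            intro x hx
            obtain ⟨hx1, hx2⟩ := Finset.mem_filter.1 hx
            obtain ⟨b, hbq, rfl⟩ := mem_firstEntries.1 hx1
            refine Finset.mem_filter.2 ⟨mem_firstEntries.2 ⟨b, ?_, rfl⟩, hx2⟩
            by_contra h
            exact absurd hx2 (not_le.2 (hb b (by omega) hbq))
          have := Finset.card_le_card this
          omega
        obtain ⟨b, hb1, hb2, hb3⟩ := hb
        have ha : ∃ a : Fin n, (a : ℕ) < carrelLast R i + 1 ∧ w < π a := by
          by_contra! ha
          rw [Finset.filter_true_of_mem] at hcon
          · omega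
          · intro x hx
            obtain ⟨a, haq, rfl⟩ := mem_firstEntries.1 hx
            exact ha a haq
        obtain ⟨a, ha1, ha2⟩ := ha
        obtain ⟨c, hc⟩ := Finite.surjective_of_injective hinj ⟨w + 1, hv1⟩
        have hcq : q ≤ c := by
          by_contra hcq
          exact hv (mem_firstEntries.2 ⟨c, by omega, hc⟩)
        have hR1 : (carrelLast R i : ℕ) + 1 ∈ R := by
          rcases isEnd_carrelLast (R := R) i with h | h
          · exact h
          · have := b.isLt
            omega
        have hR2 : q ∈ R := by
          rcases hq with h | h
          · exact h
          · have := c.isLt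
            omega
        have hne : (π a : ℕ) ≠ w + 1 := fun h =>
          hv (mem_firstEntries.2 ⟨a, by omega, Fin.ext h⟩)
        rw [Fin.lt_def] at ha2
        rw [Fin.le_def] at hb3
        refine ⟨_, hR1, _, hR2, a, b, c, ha1, hb1, hb2, hcq, ?_, ?_, ?_⟩
        · rw [Fin.lt_def]
          omega
        · rw [hc, Fin.lt_def]
          simp only
          omega
        · rw [hc, Fin.lt_def]
          simp only
          omega
      exact (hb i hi).trans (Fin.le_def.1 hle)

end RankTuple

/-! ### From gapless tuples to permutations -/

section GaplessToPerm

variable {n : ℕ} {R : Finset ℕ} {γ π : Fin n → Fin n}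

theorem rankLargest_strictAnti {d d' : ℕ} {Q : Finset (Fin n)} (h1 : 1 ≤ d) (h2 : d < d')
    (h3 : d' ≤ Q.card) (a b : Fin n) : rankLargest d' Q a < rankLargest d Q b := by
  have := rankLargest_strictMono (Q := Q) rfl (show Q.card - d' < Q.card - d by omega)
    (by omega) a b
  rwa [Nat.sub_sub_self h3, Nat.sub_sub_self (by omega)] at this

theorem gaplessToPerm_of_carrelFirst_eq_zero {i : Fin n} (h : (carrelFirst R i : ℕ) = 0) :
    gaplessToPerm R γ i = γ i := by
  rw [gaplessToPerm]
  simp [h]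

theorem gaplessToPerm_eq {e f i : Fin n} (hef : (e : ℕ) + 1 = f) (h : carrelFirst R i = f) :
    gaplessToPerm R γ i =
      if (f : ℕ) + (if γ f ≤ γ e then (γ e : ℕ) - γ f + 1 else 0) ≤ i then γ i else
        rankLargest ((f : ℕ) + (if γ f ≤ γ e then (γ e : ℕ) - γ f + 1 else 0) - i)
          ((Finset.univ.filter fun v => v ≤ γ e) \ firstEntries (gaplessToPerm R γ) f) i := by
  have he : (⟨(f : ℕ) - 1, lt_of_le_of_lt (Nat.sub_le _ _) f.isLt⟩ : Fin n) = e :=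
    Fin.ext (by simp only; omega)
  have hU : ((Finset.univ.filter fun k : Fin n => k < f).attach.image fun k =>
      gaplessToPerm R γ k.1) = firstEntries (gaplessToPerm R γ) f := by
    ext v
    simp [firstEntries]
  rw [gaplessToPerm]
  subst h
  have h0 : ¬ (carrelFirst R i : ℕ) = 0 := by omega
  simp only [h0, if_false, he, hU]

/-- The form of a permutation obtained from a gapless tuple `γ` on the carrel that starts at `f`:
the first `s` entries are the largest values below `G` not used before, while the later entries
agree with `γ`. -/
structure CarrelForm (R : Finset ℕ) (γ π : Fin n → Fin n) (f : Fin n) (s G : ℕ) : Prop where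
  used : ∀ k, k < f → (π k : ℕ) < G
  le_last : (f : ℕ) + s ≤ carrelLast R f + 1
  high : ∀ i, SameCarrel R f i → (f : ℕ) + s ≤ i → π i = γ i ∧ G ≤ γ i
  low_lt : ∀ i, SameCarrel R f i → (i : ℕ) < f + s → (π i : ℕ) < G
  low_new : ∀ i, SameCarrel R f i → (i : ℕ) < f + s → ∀ k, k < f → π k ≠ π i
  low_run : ∀ i, SameCarrel R f i → (i : ℕ) < f + s → (γ i : ℕ) + f + s = G + i
  low_mono : ∀ i j, SameCarrel R f i → SameCarrel R f j → i < j → (j : ℕ) < f + s → π i < π j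
  low_max : ∀ i, SameCarrel R f i → (i : ℕ) < f + s → ∀ v : Fin n, (v : ℕ) < G → π i < v →
    (∀ k, k < f → π k ≠ v) → ∃ j, i < j ∧ (j : ℕ) < f + s ∧ π j = v

/-- Here `G` is one more than the entry before the carrel, and `s` is the length of the run of `γ`
from `γ f` up to that entry. On the first carrel both are `0`. -/
theorem exists_carrelForm (hU : IsUpper γ) (hI : IsRIncreasing R γ) (hR : HasRuns R γ) {f : Fin n}
    (hf : carrelFirst R f = f)
    (hinj : ∀ k k', k < k' → k' < f → gaplessToPerm R γ k ≠ gaplessToPerm R γ k')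
    (hmax : ∀ e k : Fin n, (e : ℕ) + 1 = f → k < f → gaplessToPerm R γ k ≤ γ e) :
    ∃ s G, CarrelForm R γ (gaplessToPerm R γ) f s G := by
  rcases Nat.eq_zero_or_pos (f : ℕ) with hf0 | hf0
  · have hno : ∀ k : Fin n, ¬ k < f := fun k hk => by
      rw [Fin.lt_def] at hk
      omega
    have hno' : ∀ i : Fin n, SameCarrel R f i → ¬ (i : ℕ) < f + 0 := fun i hi => by omega
    refine ⟨0, 0, fun k hk => absurd hk (hno k), by omega, fun i hi _ => ⟨?_, Nat.zero_le _⟩,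
      fun i hi h => absurd h (hno' i hi), fun i hi h => absurd h (hno' i hi),
      fun i hi h => absurd h (hno' i hi), fun i j _ hj _ h => absurd h (hno' j hj),
      fun i hi h => absurd h (hno' i hi)⟩
    apply gaplessToPerm_of_carrelFirst_eq_zero
    rw [← hi.carrelFirst_eq, hf, hf0]
  · obtain ⟨e, hef⟩ : ∃ e : Fin n, (e : ℕ) + 1 = f :=
      ⟨⟨f - 1, by have := f.isLt; omega⟩, by simp only; omega⟩
    have hn : ¬ SameCarrel R e f := fun h => by
      have := Fin.le_def.1 h.symm.carrelFirst_le
      rw [hf] at this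
      omega
    have heq := fun {i : Fin n} (h : SameCarrel R f i) =>
      gaplessToPerm_eq (γ := γ) hef (h.carrelFirst_eq.symm.trans hf)
    have hrun : ∀ d, (γ f : ℕ) + d ≤ γ e →
        ∃ k : Fin n, (k : ℕ) = f + d ∧ SameCarrel R f k ∧ (γ k : ℕ) = γ f + d := by
      intro d
      induction d with
      | zero => exact fun _ => ⟨f, rfl, SameCarrel.refl f, rfl⟩
      | succ d ih =>
        intro hd
        obtain ⟨k, h1, h2, h3⟩ := ih (by omega)
        obtain ⟨k', h4, h5, h6⟩ := hR e f k hef hn h2 (Fin.lt_def.2 (by omega))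
        exact ⟨k', by omega, h5, by omega⟩
    have hfle : ∀ i : Fin n, SameCarrel R f i → (f : ℕ) ≤ i := fun i hi =>
      Fin.le_def.1 (hf ▸ hi.carrelFirst_le)
    have hmax' : ∀ k, k < f → gaplessToPerm R γ k ≤ γ e := fun k => hmax e k hef
    have hinj' : (firstEntries (gaplessToPerm R γ) f).card = f := by
      rw [firstEntries, Finset.card_image_of_injOn, card_filter_lt f.isLt.le]
      intro a ha b hb hab
      simp only [Finset.coe_filter, Finset.mem_univ, true_and, Set.mem_ofPred_eq] at ha hb
      rcases lt_trichotomy a b with h | h | h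
      · exact absurd hab (hinj a b h (Fin.lt_def.2 hb))
      · exact h
      · exact absurd hab.symm (hinj b a h (Fin.lt_def.2 ha))
    have hUf := Fin.le_def.1 (hU f)
    have hmemU : ∀ v, v ∈ firstEntries (gaplessToPerm R γ) f ↔
        ∃ k, k < f ∧ gaplessToPerm R γ k = v := fun v => mem_firstEntries
    generalize gaplessToPerm R γ = π at *
    by_cases hge : γ f ≤ γ e
    · simp only [hge, if_true] at heq
      rw [Fin.le_def] at hge
      obtain ⟨s, hs⟩ : ∃ s, s = (γ e : ℕ) - γ f + 1 := ⟨_, rfl⟩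
      simp only [← hs] at heq
      obtain ⟨A, hA⟩ : ∃ A, A = (Finset.univ.filter fun v => v ≤ γ e) \ firstEntries π f :=
        ⟨_, rfl⟩
      simp only [← hA] at heq
      have hmemA : ∀ v, v ∈ A ↔ v ≤ γ e ∧ ∀ k, k < f → π k ≠ v := by
        intro v
        simp [hA, hmemU]
      -- There are `γ e + 1` values up to `γ e`, of which `f` are used; `γ f ≥ f` leaves at least
      -- `s` of them.
      have hAc : s ≤ A.card := by
        rw [hA, Finset.card_sdiff_of_subset, hinj']
        · have : (Finset.univ.filter fun v => v ≤ γ e).card = γ e + 1 := by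
            rw [← Fin.card_Iic]
            congr 1
            ext v
            simp
          omega
        · intro v hv
          obtain ⟨k, hk, rfl⟩ := (hmemU v).1 hv
          simpa using hmax' k hk
      have hlow : ∀ i, SameCarrel R f i → (i : ℕ) < f + s →
          π i = rankLargest ((f : ℕ) + s - i) A i := by
        intro i hi his
        rw [heq hi, if_neg (by omega)]
      have hlowA : ∀ i, SameCarrel R f i → (i : ℕ) < f + s → π i ∈ A := by
        intro i hi his
        rw [hlow i hi his]
        have := hfle i hi
        exact (rankLargest_mem_and_card (by omega) (by omega) i).1
      obtain ⟨m, hm1, hm2, hm3⟩ := hrun (s - 1) (by omega)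
      have hm4 := Fin.le_def.1 hm2.le_carrelLast
      refine ⟨s, γ e + 1, fun k hk => ?_, by omega, fun i hi his => ⟨?_, ?_⟩, fun i hi his => ?_,
        fun i hi his => ?_, fun i hi his => ?_, fun i j hi hj hij hjs => ?_,
        fun i hi his v hv hiv hkv => ?_⟩
      · have := Fin.le_def.1 (hmax' k hk)
        omega
      · rw [heq hi, if_pos his]
      · have := Fin.lt_def.1 (hI m i (Fin.lt_def.2 (by omega)) (hm2.symm.trans hi))
        omega
      · have := Fin.le_def.1 ((hmemA _).1 (hlowA i hi his)).1
        omega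
      · exact ((hmemA _).1 (hlowA i hi his)).2
      · have h1 := hfle i hi
        obtain ⟨k, hk1, hk2, hk3⟩ := hrun (i - f) (by omega)
        obtain rfl : k = i := Fin.ext (by omega)
        omega
      · rw [Fin.lt_def] at hij
        have := hfle i hi
        rw [hlow i hi (by omega), hlow j hj hjs]
        exact rankLargest_strictAnti (by omega) (by omega) (by omega) _ _
      -- The value `v` has rank `A.card - k` from the top, less than that of `π i`; so it was placed
      -- that many positions before `f + s`.
      · have hvA : v ∈ A := (hmemA v).2 ⟨Fin.le_def.2 (by omega), hkv⟩
        obtain ⟨k, hk1, hk2⟩ := exists_rankLargest_eq rfl hvA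
        have hfi := hfle i hi
        have hd : A.card - k < f + s - i := by
          by_contra! hcon
          rw [hlow i hi his, ← hk2 i] at hiv
          rcases hcon.eq_or_lt with h | h
          · rw [h] at hiv
            exact lt_irrefl _ hiv
          · exact lt_asymm hiv (rankLargest_strictAnti (by omega) h (by omega) _ _)
        have hjn : f + s - (A.card - k) < n := by
          have := (carrelLast R f).isLt
          omega
        have hj : SameCarrel R f ⟨f + s - (A.card - k), hjn⟩ := by
          apply sameCarrel_of_between
          · rw [hf]
            exact Fin.le_def.2 (by simp only; omega)
          · exact Fin.le_def.2 (by simp only; omega)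
        refine ⟨⟨f + s - (A.card - k), hjn⟩, Fin.lt_def.2 (by simp only; omega),
          by simp only; omega, ?_⟩
        rw [hlow _ hj (by simp only; omega)]
        simp only
        rw [show (f : ℕ) + s - (f + s - (A.card - k)) = A.card - k by omega]
        exact hk2 _
    · simp only [hge, if_false, add_zero] at heq
      rw [Fin.le_def] at hge
      have hlf : (f : ℕ) ≤ carrelLast R f := Fin.le_def.1 (le_carrelLast f)
      have hno' : ∀ i : Fin n, SameCarrel R f i → ¬ (i : ℕ) < f + 0 := fun i hi => by
        have := hfle i hi
        omega
      refine ⟨0, γ e + 1, fun k hk => ?_, by omega, fun i hi _ => ⟨?_, ?_⟩,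
        fun i hi h => absurd h (hno' i hi), fun i hi h => absurd h (hno' i hi),
        fun i hi h => absurd h (hno' i hi), fun i j _ hj _ h => absurd h (hno' j hj),
        fun i hi h => absurd h (hno' i hi)⟩
      · have := Fin.le_def.1 (hmax' k hk)
        omega
      · rw [heq hi, if_pos (hfle i hi)]
      · have := hI.add_sub_le (Fin.le_def.2 (hfle i hi)) hi
        have := hfle i hi
        omega

namespace CarrelForm

variable {f : Fin n} {s G : ℕ}

theorem lt_of_lt (h : CarrelForm R γ π f s G) (hI : IsRIncreasing R γ) {i j : Fin n}
    (hi : SameCarrel R f i) (hj : SameCarrel R f j) (hij : i < j) : π i < π j := by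
  rcases lt_or_ge (j : ℕ) (f + s) with h1 | h1
  · exact h.low_mono i j hi hj hij h1
  · obtain ⟨h2, h3⟩ := h.high j hj h1
    rw [h2]
    rcases lt_or_ge (i : ℕ) (f + s) with h4 | h4
    · exact Fin.lt_def.2 (by have := h.low_lt i hi h4; omega)
    · rw [(h.high i hi h4).1]
      exact hI i j hij (hi.symm.trans hj)

theorem ne_of_lt (h : CarrelForm R γ π f s G) (hI : IsRIncreasing R γ)
    (hf : carrelFirst R f = f) (hinj : ∀ k k', k < k' → k' < f → π k ≠ π k') {k k' : Fin n}
    (hk : k < k') (hk' : k' ≤ carrelLast R f) : π k ≠ π k' := by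
  rcases lt_or_ge k' f with h1 | h1
  · exact hinj k k' hk h1
  have hs' : SameCarrel R f k' := sameCarrel_of_between (hf.le.trans h1) hk'
  rcases lt_or_ge k f with h2 | h2
  · rcases lt_or_ge (k' : ℕ) (f + s) with h3 | h3
    · exact h.low_new k' hs' h3 k h2
    · obtain ⟨h4, h5⟩ := h.high k' hs' h3
      have := h.used k h2
      rw [h4]
      intro he
      rw [he] at this
      omega
  · exact (h.lt_of_lt hI (sameCarrel_of_between (hf.le.trans h2) (hk.le.trans hk')) hs' hk).ne

/-- If `v` were missing, `low_max` would force all `s` low entries to exceed `v`. They are distinct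
and below `G`, but there are fewer than `s` values strictly between `v` and `G`. -/
theorem exists_of_lt (h : CarrelForm R γ π f s G) (hI : IsRIncreasing R γ)
    (hf : carrelFirst R f = f) (v : Fin n) (hv1 : G ≤ v + s) (hv2 : (v : ℕ) < G) :
    ∃ k : Fin n, (k : ℕ) < f + s ∧ π k = v := by
  by_contra! hcon
  have hl := h.le_last
  have hlow : ∀ j, SameCarrel R f j → (j : ℕ) < f + s → v < π j := by
    intro j hj hjs
    rcases lt_trichotomy v (π j) with h1 | h1 | h1
    · exact h1
    · exact absurd h1.symm (hcon j hjs)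
    · obtain ⟨j', _, h3, h4⟩ := h.low_max j hj hjs v hv2 h1 fun k hk =>
        hcon k (by rw [Fin.lt_def] at hk; omega)
      exact absurd h4 (hcon j' h3)
  obtain ⟨m, hm⟩ : ∃ m : Fin n, (m : ℕ) + 1 = f + s :=
    ⟨⟨f + s - 1, by have := (carrelLast R f).isLt; omega⟩, by simp only; omega⟩
  have hsame : ∀ j ∈ Finset.Icc f m, SameCarrel R f j := by
    intro j hj
    rw [Finset.mem_Icc, Fin.le_def, Fin.le_def] at hj
    exact sameCarrel_of_between (by rw [hf, Fin.le_def]; omega) (Fin.le_def.2 (by omega))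
  have hcard : (Finset.Icc f m).card ≤ (Finset.Ioo (v : ℕ) G).card := by
    apply Finset.card_le_card_of_injOn (fun j => (π j : ℕ))
    · intro j hj
      have hj' := Finset.mem_Icc.1 hj
      rw [Fin.le_def, Fin.le_def] at hj'
      simp only [Finset.coe_Ioo, Set.mem_Ioo]
      exact ⟨hlow j (hsame j hj) (by omega), h.low_lt j (hsame j hj) (by omega)⟩
    · intro a ha b hb hab
      rcases lt_trichotomy a b with h1 | h1 | h1
      · exact absurd (Fin.ext hab) (h.lt_of_lt hI (hsame a ha) (hsame b hb) h1).ne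
      · exact h1
      · exact absurd (Fin.ext hab.symm) (h.lt_of_lt hI (hsame b hb) (hsame a ha) h1).ne
  rw [Fin.card_Icc, Nat.card_Ioo] at hcard
  omega

theorem mem_firstEntries (h : CarrelForm R γ π f s G) (hI : IsRIncreasing R γ)
    (hf : carrelFirst R f = f) {i : Fin n} (hi : SameCarrel R f i) :
    γ i ∈ firstEntries π (carrelLast R f + 1) := by
  have h1 := Fin.le_def.1 hi.le_carrelLast
  have h2 : (f : ℕ) ≤ i := Fin.le_def.1 (hf ▸ hi.carrelFirst_le)
  have h3 := h.le_last
  rw [ParabolicCatalan.mem_firstEntries]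
  rcases lt_or_ge (i : ℕ) (f + s) with h4 | h4
  · have h5 := h.low_run i hi h4
    obtain ⟨k, hk, hk'⟩ := h.exists_of_lt hI hf (γ i) (by omega) (by omega)
    exact ⟨k, by omega, hk'⟩
  · exact ⟨i, by omega, (h.high i hi h4).1⟩

/-- High entries are values of `γ` already. An earlier or low entry above `γ i` is less than `G`,
hence lies in the run of `γ` that starts at `γ i` and ends at `G - 1`. -/
theorem filter_firstEntries (h : CarrelForm R γ π f s G) (hI : IsRIncreasing R γ)
    (hf : carrelFirst R f = f) {i : Fin n} (hi : SameCarrel R f i) :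
    ((firstEntries π (carrelLast R f + 1)).filter fun x => γ i < x) =
      (Finset.Ioc i (carrelLast R f)).image γ := by
  have hif : (f : ℕ) ≤ i := Fin.le_def.1 (hf ▸ hi.carrelFirst_le)
  have hl := h.le_last
  ext x
  simp only [Finset.mem_filter, Finset.mem_image, Finset.mem_Ioc]
  constructor
  · rintro ⟨hx, hlt⟩
    obtain ⟨k, hk, rfl⟩ := ParabolicCatalan.mem_firstEntries.1 hx
    have hk' : k ≤ carrelLast R f := Fin.le_def.2 (by omega)
    by_cases hk2 : (f : ℕ) + s ≤ k
    · have hks : SameCarrel R f k := sameCarrel_of_between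
        (by rw [hf, Fin.le_def]; omega) hk'
      rw [(h.high k hks hk2).1] at hlt ⊢
      refine ⟨k, ⟨?_, hk'⟩, rfl⟩
      by_contra hcon
      rcases (not_lt.1 hcon).eq_or_lt with h1 | h1
      · exact hlt.ne (h1 ▸ rfl)
      · exact lt_asymm hlt (hI k i h1 (hks.symm.trans hi))
    · have hG : (π k : ℕ) < G := by
        rcases lt_or_ge k f with h1 | h1
        · exact h.used k h1
        · exact h.low_lt k (sameCarrel_of_between (hf.le.trans h1) hk') (by omega)
      rw [Fin.lt_def] at hlt
      have hilow : (i : ℕ) < f + s := by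
        by_contra hcon
        have := (h.high i hi (by omega)).2
        omega
      have h1 := h.low_run i hi hilow
      -- The index is read off from `low_run`: it is where the run of `γ` takes the value `π k`.
      obtain ⟨j, hj⟩ : ∃ j : Fin n, (j : ℕ) = π k + f + s - G :=
        ⟨⟨π k + f + s - G, by have := (carrelLast R f).isLt; omega⟩, rfl⟩
      have hjl : j ≤ carrelLast R f := Fin.le_def.2 (by omega)
      have hjs : SameCarrel R f j := sameCarrel_of_between (by rw [hf, Fin.le_def]; omega) hjl
      have h2 := h.low_run j hjs (by omega)
      exact ⟨j, ⟨Fin.lt_def.2 (by omega), hjl⟩, Fin.ext (by omega)⟩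
  · rintro ⟨j, ⟨h1, h2⟩, rfl⟩
    have hj : SameCarrel R f j := sameCarrel_of_between
      ((hi.carrelFirst_le).trans h1.le) h2
    exact ⟨h.mem_firstEntries hI hf hj, hI i j h1 (hi.symm.trans hj)⟩

theorem card_filter_firstEntries (h : CarrelForm R γ π f s G) (hI : IsRIncreasing R γ)
    (hf : carrelFirst R f = f) {i : Fin n} (hi : SameCarrel R f i) :
    ((firstEntries π (carrelLast R f + 1)).filter fun x => γ i < x).card =
      carrelLast R f - i := by
  rw [h.filter_firstEntries hI hf hi, Finset.card_image_of_injOn, Fin.card_Ioc]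
  have hs : ∀ j ∈ Finset.Ioc i (carrelLast R f), SameCarrel R f j := fun j hj =>
    sameCarrel_of_between ((hi.carrelFirst_le).trans (Finset.mem_Ioc.1 hj).1.le)
      (Finset.mem_Ioc.1 hj).2
  intro a ha b hb hab
  rcases lt_trichotomy a b with h1 | h1 | h1
  · exact absurd hab (hI a b h1 ((hs a ha).symm.trans (hs b hb))).ne
  · exact h1
  · exact absurd hab.symm (hI b a h1 ((hs b hb).symm.trans (hs a ha))).ne

end CarrelForm

/-- Induction over carrels: these two facts are what `exists_carrelForm` requires, and the form on
one carrel yields them for the next. -/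
theorem gaplessToPerm_before (hU : IsUpper γ) (hI : IsRIncreasing R γ) (hR : HasRuns R γ) :
    ∀ (m : ℕ) (f : Fin n), (f : ℕ) = m → carrelFirst R f = f →
      (∀ k k', k < k' → k' < f → gaplessToPerm R γ k ≠ gaplessToPerm R γ k') ∧
      ∀ e k : Fin n, (e : ℕ) + 1 = f → k < f → gaplessToPerm R γ k ≤ γ e := by
  intro m
  induction m using Nat.strong_induction_on with
  | _ m ih =>
    intro f hm hf
    rcases Nat.eq_zero_or_pos (f : ℕ) with hf0 | hf0
    · have hno : ∀ k : Fin n, ¬ k < f := fun k hk => by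
        rw [Fin.lt_def] at hk
        omega
      exact ⟨fun _ k' _ h => absurd h (hno k'), fun _ k _ h => absurd h (hno k)⟩
    obtain ⟨e, hef⟩ : ∃ e : Fin n, (e : ℕ) + 1 = f :=
      ⟨⟨f - 1, by have := f.isLt; omega⟩, by simp only; omega⟩
    have hn : ¬ SameCarrel R e f := fun h => by
      have := Fin.le_def.1 h.symm.carrelFirst_le
      rw [hf] at this
      omega
    have hse := sameCarrel_carrelFirst (R := R) e
    have hfe := Fin.le_def.1 (carrelFirst_le (R := R) e)
    have hff : carrelFirst R (carrelFirst R e) = carrelFirst R e := hse.symm.carrelFirst_eq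
    have hl : carrelLast R (carrelFirst R e) = e :=
      hse.symm.carrelLast_eq.trans (carrelLast_eq_of_not_sameCarrel hef hn)
    obtain ⟨h1, h2⟩ := ih (carrelFirst R e) (by omega) _ rfl hff
    obtain ⟨s, G, hF⟩ := exists_carrelForm hU hI hR hff h1 h2
    have hle : ∀ k, k < f → k ≤ carrelLast R (carrelFirst R e) := fun k hk => by
      rw [hl, Fin.le_def]
      rw [Fin.lt_def] at hk
      omega
    refine ⟨fun k k' hk hk' => hF.ne_of_lt hI hff h1 hk (hle k' hk'), ?_⟩
    intro e' k he' hk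
    obtain rfl : e' = e := Fin.ext (by omega)
    -- At the last index of a carrel the count of larger entries is zero, so `γ e` bounds everything
    -- placed so far.
    have h3 := hF.card_filter_firstEntries hI hff hse.symm
    rw [hl, Nat.sub_self, Finset.card_eq_zero, Finset.filter_eq_empty_iff] at h3
    exact not_lt.1 (h3 (mem_firstEntries.2 ⟨k, by rw [Fin.lt_def] at hk; omega, rfl⟩))

theorem exists_carrelForm_gaplessToPerm (hU : IsUpper γ) (hI : IsRIncreasing R γ)
    (hR : HasRuns R γ) (i : Fin n) :
    ∃ s G, CarrelForm R γ (gaplessToPerm R γ) (carrelFirst R i) s G := by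
  have hff := (sameCarrel_carrelFirst (R := R) i).symm.carrelFirst_eq
  obtain ⟨h1, h2⟩ := gaplessToPerm_before hU hI hR _ _ rfl hff
  exact exists_carrelForm hU hI hR hff h1 h2

theorem isRPermutation_gaplessToPerm (hU : IsUpper γ) (hI : IsRIncreasing R γ)
    (hR : HasRuns R γ) : IsRPermutation R (gaplessToPerm R γ) := by
  constructor
  · have key : ∀ a b, a < b → gaplessToPerm R γ a ≠ gaplessToPerm R γ b := by
      intro a b hab
      have hs := sameCarrel_carrelFirst (R := R) b
      obtain ⟨s, G, hF⟩ := exists_carrelForm_gaplessToPerm hU hI hR b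
      exact hF.ne_of_lt hI hs.symm.carrelFirst_eq
        (gaplessToPerm_before hU hI hR _ _ rfl hs.symm.carrelFirst_eq).1 hab
        hs.symm.le_carrelLast
    intro a b hab
    rcases lt_trichotomy a b with h | h | h
    · exact absurd hab (key a b h)
    · exact h
    · exact absurd hab.symm (key b a h)
  · intro i j hij hs
    obtain ⟨s, G, hF⟩ := exists_carrelForm_gaplessToPerm hU hI hR i
    have h := (sameCarrel_carrelFirst (R := R) i).symm
    exact hF.lt_of_lt hI h (h.trans hs) hij

/-- The value `γ i` occurs among the entries up to the end of its carrel, and the larger ones are as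
many as the indices after `i` in the carrel. -/
theorem rankTuple_gaplessToPerm (hU : IsUpper γ) (hI : IsRIncreasing R γ)
    (hR : HasRuns R γ) : rankTuple R (gaplessToPerm R γ) = γ := by
  funext i
  obtain ⟨s, G, hF⟩ := exists_carrelForm_gaplessToPerm hU hI hR i
  have h := (sameCarrel_carrelFirst (R := R) i).symm
  have hc := card_firstEntries (isRPermutation_gaplessToPerm hU hI hR).1
    (m := (carrelLast R (carrelFirst R i) : ℕ) + 1) (Fin.isLt _)
  have hl := Fin.le_def.1 h.le_carrelLast
  rw [rankTuple_eq h.symm.carrelLast_eq]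
  refine rankLargest_eq_of_card (by omega) (by omega) i
    (hF.mem_firstEntries hI h.carrelFirst_eq h) ?_
  rw [hF.card_filter_firstEntries hI h.carrelFirst_eq h]
  omega

/-- In a 312 pattern `π b < π a < G`, so `b` is a low position. Then `π c` is a larger value below
`G` not used earlier, and maximality of the low entries would place it already in the carrel of `b`.
-/
theorem isR312Avoiding_gaplessToPerm (hU : IsUpper γ) (hI : IsRIncreasing R γ)
    (hR : HasRuns R γ) : IsR312Avoiding R (gaplessToPerm R γ) := by
  have hperm := isRPermutation_gaplessToPerm hU hI hR
  refine ⟨hperm, ?_⟩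
  rintro ⟨q, hq, q', hq', a, b, c, haq, hqb, hbq', hqc, h1, h2, h3⟩
  obtain ⟨s, G, hF⟩ := exists_carrelForm_gaplessToPerm hU hI hR b
  have h := (sameCarrel_carrelFirst (R := R) b).symm
  have hqf := le_carrelFirst_of_mem hq hqb
  have haG := hF.used a (Fin.lt_def.2 (by omega))
  have hfb := Fin.le_def.1 (carrelFirst_le (R := R) b)
  have hlast := carrelLast_lt_of_isEnd (R := R) (Or.inl hq')
    (show (carrelFirst R b : ℕ) < q' by omega)
  have hl := hF.le_last
  rw [Fin.lt_def] at h1 h3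
  have hblow : (b : ℕ) < carrelFirst R b + s := by
    by_contra hcon
    obtain ⟨h4, h5⟩ := hF.high b h (by omega)
    rw [h4] at h1
    omega
  obtain ⟨j, _, hj2, hj3⟩ := hF.low_max b h hblow _ (by omega) h2 fun k hk he => by
    have := hperm.1 he
    subst this
    rw [Fin.lt_def] at hk
    omega
  have := hperm.1 hj3
  subst this
  omega

end GaplessToPerm

/-! ### Columns and scanning tableaux -/

section Scan

variable {μ : YoungDiagram} (T : SemistandardYoungTableau μ)

theorem length_columnUp (j : ℕ) : (columnUp T j).length = μ.colLen j := by simp [columnUp]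

theorem mem_columnUp {j x : ℕ} : x ∈ columnUp T j ↔ ∃ i < μ.colLen j, T i j = x := by
  simp [columnUp]

theorem columnUp_pairwise (j : ℕ) : (columnUp T j).Pairwise (· > ·) := by
  rw [columnUp, List.pairwise_reverse, List.pairwise_map]
  refine List.pairwise_lt_range.imp_of_mem fun _ hb hab => ?_
  exact T.col_strict hab (YoungDiagram.mem_iff_lt_colLen.2 (List.mem_range.1 hb))

theorem eq_of_cons_suffix_columnUp {j x : ℕ} {c : List ℕ} (h : (x :: c) <:+ columnUp T j) :
    c.length < μ.colLen j ∧ T c.length j = x := by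
  obtain ⟨t, ht⟩ := h
  have h1 : (List.range (μ.colLen j)).map (fun i => T i j) = c.reverse ++ x :: t.reverse := by
    rw [← List.reverse_reverse (List.map _ _), ← columnUp, ← ht]
    simp
  have h2 : c.length < μ.colLen j := by
    have := congrArg List.length h1
    simp at this
    omega
  have h3 := congrArg (fun l => l[c.length]?) h1
  simp [h2] at h3
  exact ⟨h2, h3⟩

theorem columnUp_rowLE {j j' : ℕ} (h : j < j') : RowLE (columnUp T j) (columnUp T j') := by
  intro x c y d hx hy hcd
  obtain ⟨_, rfl⟩ := eq_of_cons_suffix_columnUp T hx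
  obtain ⟨h1, rfl⟩ := eq_of_cons_suffix_columnUp T hy
  rw [hcd]
  exact T.row_weak h (YoungDiagram.mem_iff_lt_colLen.2 h1)

/-- The columns to the right of column `j`. -/
def rightColumns (j : ℕ) : List (List ℕ) :=
  (List.range (μ.rowLen 0 - (j + 1))).map fun k => columnUp T (j + 1 + k)

theorem mem_rightColumns {j : ℕ} {c : List ℕ} (h : c ∈ rightColumns T j) :
    ∃ j', j < j' ∧ c = columnUp T j' := by
  obtain ⟨k, _, rfl⟩ := List.mem_map.1 h
  exact ⟨_, by omega, rfl⟩

theorem mem_cons_rightColumns {j : ℕ} {c : List ℕ} (h : c ∈ columnUp T j :: rightColumns T j) :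
    ∃ j', j ≤ j' ∧ c = columnUp T j' := by
  rcases List.mem_cons.1 h with rfl | h
  · exact ⟨j, le_rfl, rfl⟩
  · obtain ⟨j', h1, h2⟩ := mem_rightColumns T h
    exact ⟨j', h1.le, h2⟩

theorem pairwise_rightColumns (j : ℕ) :
    (columnUp T j :: rightColumns T j).Pairwise RowLE := by
  refine List.pairwise_cons.2 ⟨fun c hc => ?_, ?_⟩
  · obtain ⟨j', h, rfl⟩ := mem_rightColumns T hc
    exact columnUp_rowLE T h
  · rw [rightColumns, List.pairwise_map]
    exact List.pairwise_lt_range.imp fun h => columnUp_rowLE T (by omega)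

theorem length_scanColumn_columnUp (j : ℕ) :
    (scanColumn (columnUp T j) (rightColumns T j)).length = μ.colLen j := by
  rw [length_scanColumn, length_columnUp]

theorem scan_eq_getElem {i j : ℕ} (h : i < μ.colLen j) :
    scan T i j = (scanColumn (columnUp T j) (rightColumns T j))[μ.colLen j - 1 - i]'(by
      rw [length_scanColumn_columnUp]; omega) := by
  have h1 := length_scanColumn_columnUp T j
  change (scanColumn (columnUp T j) (rightColumns T j)).reverse.getD i 0 = _
  rw [List.getD_eq_getElem _ _ (by rw [List.length_reverse]; omega), List.getElem_reverse]
  simp only [h1]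

theorem columnUp_getElem {i j : ℕ} (h : i < μ.colLen j) :
    (columnUp T j)[μ.colLen j - 1 - i]'(by rw [length_columnUp]; omega) = T i j := by
  simp only [columnUp, List.getElem_reverse, List.getElem_map, List.getElem_range,
    List.length_map, List.length_range]
  rw [show μ.colLen j - 1 - (μ.colLen j - 1 - i) = i by omega]

theorem le_scan {i j : ℕ} (h : i < μ.colLen j) : T i j ≤ scan T i j := by
  rw [scan_eq_getElem T h, ← columnUp_getElem T h]
  exact le_getElem_scanColumn _ _ _ _

theorem scan_lt_scan_succ {i j : ℕ} (h : i + 1 < μ.colLen j) :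
    scan T i j < scan T (i + 1) j := by
  rw [scan_eq_getElem T h, scan_eq_getElem T (show i < μ.colLen j by omega)]
  have hp := List.isChain_iff_pairwise.1 (scanColumn_isChain (columnUp T j) (rightColumns T j)
    (columnUp_pairwise T j) fun c hc => by
      obtain ⟨j', _, rfl⟩ := mem_rightColumns T hc
      exact columnUp_pairwise T j')
  exact List.pairwise_iff_getElem.1 hp _ _ _ _ (by omega)

/-- Scanning preserves weakly increasing row bounds. -/
theorem scan_le_of_monotone {f : ℕ → ℕ} (hf : Monotone f)
    (hT : ∀ i j, (i, j) ∈ μ → T i j ≤ f i) {i j : ℕ} (h : i < μ.colLen j) :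
    scan T i j ≤ f i := by
  have hb := scanColumn_boundedBy hf (columnUp T j) (rightColumns T j)
    (fun c hc => by
      obtain ⟨j', h1, rfl⟩ := mem_cons_rightColumns T hc
      rw [length_columnUp, length_columnUp]
      exact μ.colLen_anti _ _ h1)
    (fun c hc => by
      obtain ⟨j', h1, rfl⟩ := mem_cons_rightColumns T hc
      exact columnUp_pairwise T j')
    (pairwise_rightColumns T j)
    (fun c hc => by
      obtain ⟨j', h1, rfl⟩ := mem_cons_rightColumns T hc
      intro x c hx
      obtain ⟨h2, rfl⟩ := eq_of_cons_suffix_columnUp T hx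
      exact hT _ _ (YoungDiagram.mem_iff_lt_colLen.2 h2))
  rw [scan_eq_getElem T h]
  have h1 := length_scanColumn_columnUp T j
  have h2 : μ.colLen j - 1 - i < (scanColumn (columnUp T j) (rightColumns T j)).length := by
    omega
  have h3 := hb _ _ (by
    rw [← List.drop_eq_getElem_cons h2]
    exact List.drop_suffix _ _)
  rw [List.length_drop, h1] at h3
  refine h3.trans (hf (by omega))

/-- A tableau whose columns are nested is equal to its scanning tableau. -/
theorem scan_eq_self (hT : ∀ j j', j < j' → columnUp T j' ⊆ columnUp T j) {i j : ℕ}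
    (h : i < μ.colLen j) : scan T i j = T i j := by
  have heq := scanColumn_eq_self (columnUp T j) (rightColumns T j) (columnUp_pairwise T j)
    (fun c hc => by
      obtain ⟨j', _, rfl⟩ := mem_rightColumns T hc
      exact columnUp_pairwise T j')
    (fun c hc => by
      obtain ⟨j', h1, rfl⟩ := mem_rightColumns T hc
      exact hT _ _ h1)
  rw [scan_eq_getElem T h, ← columnUp_getElem T h]
  simp only [heq]

end Scan

/-! ### Row bound sets and Demazure sets -/

section Sets

variable {n : ℕ} {μ : YoungDiagram}

theorem isEnd_colLen (hμ : μ.colLen 0 ≤ n) {i j : ℕ} (h : i < μ.colLen j) :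
    IsEnd n (colLengths n μ) (μ.colLen j) := by
  have h0 := μ.colLen_anti 0 j (Nat.zero_le _)
  rcases (h0.trans hμ).lt_or_eq with h1 | h1
  · refine Or.inl (Finset.mem_filter.2 ⟨Finset.mem_image.2 ⟨j, ?_, rfl⟩, h1⟩)
    rw [Finset.mem_range, ← YoungDiagram.mem_iff_lt_rowLen, YoungDiagram.mem_iff_lt_colLen]
    omega
  · exact Or.inr h1

theorem colLen_le (hμ : μ.colLen 0 ≤ n) (j : ℕ) : μ.colLen j ≤ n :=
  (μ.colLen_anti 0 j (Nat.zero_le _)).trans hμ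

theorem mem_tableaux {T : SemistandardYoungTableau μ} :
    T ∈ tableaux n μ ↔ ∀ i j, (i, j) ∈ μ → T i j < n := by
  simp [tableaux]

theorem mem_rowBoundSet {β : Fin n → Fin n} {T : SemistandardYoungTableau μ} :
    T ∈ rowBoundSet μ β ↔ T ∈ tableaux n μ ∧ IsUpper β ∧
      ∀ (i : Fin n) (j : ℕ), ((i : ℕ), j) ∈ μ → T i j ≤ β i := by
  simp [rowBoundSet, IsUpper]

theorem mem_demazureSet {π : Fin n → Fin n} {T : SemistandardYoungTableau μ} :
    T ∈ demazureSet μ π ↔ T ∈ tableaux n μ ∧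
      ∀ (i : Fin n) (j : ℕ), ((i : ℕ), j) ∈ μ → scan T i j ≤ keyEntry μ π i j := by
  simp [demazureSet]

theorem add_sub_le_of_lt_succ {q : ℕ} {t : ℕ → ℕ} (ht : ∀ i, i + 1 < q → t i < t (i + 1))
    (a d : ℕ) (h : a + d < q) : t a + d ≤ t (a + d) := by
  induction d with
  | zero => simp
  | succ d ih =>
    have h1 := ih (by omega)
    have h2 := ht (a + d) (by omega)
    rw [show a + (d + 1) = a + d + 1 from rfl]
    omega

/-- Row bounds on a strictly increasing column can be replaced by the core. -/
theorem le_core_of_column {R : Finset ℕ} {β : Fin n → Fin n} (hβ : IsUpper β) {q : ℕ}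
    (hq : IsEnd n R q) {t : ℕ → ℕ} (ht : ∀ i, i + 1 < q → t i < t (i + 1))
    (hb : ∀ i : Fin n, (i : ℕ) < q → t i ≤ β i) (i : Fin n) (hi : (i : ℕ) < q) :
    t i ≤ core R β i := by
  have hx := isNextCritical_nextCritical (R := R) (υ := β) i
  generalize nextCritical R β i = x at hx
  have h1 := hx.core_add hβ
  -- The column length is the end of a carrel, so a column that reaches row `i` also reaches row
  -- `x`.
  have h2 := (hx.same.lt_iff hq).1 hi
  have h3 := hb x h2
  have h4 := Fin.le_def.1 hx.le
  have h5 := add_sub_le_of_lt_succ ht i (x - i) (by omega)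
  rw [Nat.add_sub_cancel' h4] at h5
  omega

theorem mem_rowBoundSet_iff_core (hμ : μ.colLen 0 ≤ n) {β : Fin n → Fin n} (hβ : IsUpper β)
    {T : SemistandardYoungTableau μ} :
    T ∈ rowBoundSet μ β ↔ T ∈ tableaux n μ ∧
      ∀ (i : Fin n) (j : ℕ), ((i : ℕ), j) ∈ μ → T i j ≤ core (colLengths n μ) β i := by
  rw [mem_rowBoundSet]
  constructor
  · rintro ⟨h1, _, h2⟩
    refine ⟨h1, fun i j hij => ?_⟩
    have hi := YoungDiagram.mem_iff_lt_colLen.1 hij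
    exact le_core_of_column hβ (isEnd_colLen hμ hi) (t := fun k => T k j)
      (fun k hk => T.col_strict (Nat.lt_succ_self k) (YoungDiagram.mem_iff_lt_colLen.2 hk))
      (fun k hk => h2 k j (YoungDiagram.mem_iff_lt_colLen.2 hk)) i hi
  · rintro ⟨h1, h2⟩
    exact ⟨h1, hβ, fun i j hij => (h2 i j hij).trans (Fin.le_def.1 (core_le hβ i))⟩

theorem rowBoundSet_eq_of_core_eq (hμ : μ.colLen 0 ≤ n) {β β' : Fin n → Fin n} (hβ : IsUpper β)
    (hβ' : IsUpper β') (h : core (colLengths n μ) β = core (colLengths n μ) β') :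
    rowBoundSet μ β = rowBoundSet μ β' := by
  ext T
  rw [mem_rowBoundSet_iff_core hμ hβ, mem_rowBoundSet_iff_core hμ hβ', h]

/-- The last column that meets row `i` ends with the carrel of `i`. -/
theorem exists_last_column (hμ : μ.colLen 0 ≤ n) {i : Fin n} {j : ℕ} (h : ((i : ℕ), j) ∈ μ) :
    ∃ j', j ≤ j' ∧ ((i : ℕ), j') ∈ μ ∧
      (carrelLast (colLengths n μ) i : ℕ) + 1 = μ.colLen j' := by
  have hj := YoungDiagram.mem_iff_lt_rowLen.1 h
  have hm : ((i : ℕ), μ.rowLen i - 1) ∈ μ := YoungDiagram.mem_iff_lt_rowLen.2 (by omega)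
  have hi := YoungDiagram.mem_iff_lt_colLen.1 hm
  refine ⟨μ.rowLen i - 1, by omega, hm, ?_⟩
  have h1 := carrelLast_lt_of_isEnd (isEnd_colLen hμ hi) hi
  -- Otherwise the carrel ends at the length of a shorter column. That column still meets row `i`,
  -- so it is not to the right of the last one and cannot be shorter.
  by_contra hne
  have h2 := colLen_le hμ (μ.rowLen i - 1)
  rcases isEnd_carrelLast (R := colLengths n μ) i with h3 | h3
  · obtain ⟨h4, _⟩ := Finset.mem_filter.1 h3
    obtain ⟨j'', _, h5⟩ := Finset.mem_image.1 h4
    have h6 := Fin.le_def.1 (le_carrelLast (R := colLengths n μ) i)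
    have h7 : ((i : ℕ), j'') ∈ μ := YoungDiagram.mem_iff_lt_colLen.2 (by omega)
    have h8 := YoungDiagram.mem_iff_lt_rowLen.1 h7
    have h9 := μ.colLen_anti j'' (μ.rowLen i - 1) (by omega)
    omega
  · omega

/-- For a 312-avoiding permutation, the Demazure tableaux are given by row bounds. -/
theorem demazureSet_eq_rowBoundSet (hμ : μ.colLen 0 ≤ n) {π φ : Fin n → Fin n}
    (hπ : IsR312Avoiding (colLengths n μ) π) (hφ : IsUpperFlag φ)
    (hc : core (colLengths n μ) φ = rankTuple (colLengths n μ) π) :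
    demazureSet μ π = rowBoundSet μ φ := by
  ext T
  rw [mem_demazureSet]
  constructor
  · rintro ⟨h1, h2⟩
    rw [mem_rowBoundSet_iff_core hμ hφ.1]
    refine ⟨h1, fun i j hij => ?_⟩
    obtain ⟨j', hj, hij', hl⟩ := exists_last_column hμ hij
    have h3 : T i j ≤ T i j' := T.row_weak_of_le hj hij'
    have h4 := le_scan T (YoungDiagram.mem_iff_lt_colLen.1 hij')
    have h5 := h2 i j' hij'
    rw [hc, rankTuple_eq rfl, hl]
    exact h3.trans (h4.trans h5)
  · intro hT
    obtain ⟨h1, _, h2⟩ := mem_rowBoundSet.1 hT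
    refine ⟨h1, fun i j hij => ?_⟩
    have hi := YoungDiagram.mem_iff_lt_colLen.1 hij
    have hn : ∀ {i j : ℕ}, (i, j) ∈ μ → i < n := fun h =>
      (YoungDiagram.mem_iff_lt_colLen.1 h).trans_le (colLen_le hμ _)
    -- The value `n` beyond the last row serves only to keep the extension of `φ` monotone.
    let f : ℕ → ℕ := fun k => if h : k < n then φ ⟨k, h⟩ else n
    have hf : Monotone f := by
      intro a b hab
      simp only [f]
      split_ifs with ha hb hb
      · exact Fin.le_def.1 (hφ.2 (Fin.le_def.2 hab))
      · exact (φ _).isLt.le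
      · omega
      · exact le_rfl
    have hs : ∀ k : Fin n, (k : ℕ) < μ.colLen j → scan T k j ≤ φ k := by
      intro k hk
      have := scan_le_of_monotone T hf (fun i j hij => by
        simp only [f, dif_pos (hn hij)]
        exact h2 ⟨i, hn hij⟩ j hij) hk
      simpa [f] using this
    have hmono : ∀ k, k + 1 < μ.colLen j → scan T k j < scan T (k + 1) j := fun k hk =>
      scan_lt_scan_succ T hk
    have hend := isEnd_colLen hμ hi
    have hcore := le_core_of_column hφ.1 hend (t := fun k => scan T k j) hmono hs
    rw [hc] at hcore
    exact hπ.le_rankLargest hend (colLen_le hμ j) (t := fun k => scan T k j) hmono hcore i hi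

end Sets

/-! ### Keys -/

section Key

variable {n : ℕ} {μ : YoungDiagram} {π π' : Fin n → Fin n}

/-- The key `Y_λ(π)` as a tableau. -/
def keyTableau (hμ : μ.colLen 0 ≤ n) (hπ : Function.Injective π) :
    SemistandardYoungTableau μ where
  entry i j := if h : (i, j) ∈ μ then
    keyEntry μ π ⟨i, (YoungDiagram.mem_iff_lt_colLen.1 h).trans_le (colLen_le hμ j)⟩ j else 0
  row_weak' := by
    intro i j1 j2 hj h2
    have h1 : (i, j1) ∈ μ := μ.up_left_mem le_rfl hj.le h2
    rw [dif_pos h1, dif_pos h2]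
    have hi2 := YoungDiagram.mem_iff_lt_colLen.1 h2
    apply Fin.le_def.1
    rw [keyEntry, rankLargest_le_iff (card_firstEntries hπ (colLen_le hμ j1))
      (YoungDiagram.mem_iff_lt_colLen.1 h1)]
    have h3 := card_filter_le_rankLargest (card_firstEntries hπ (colLen_le hμ j2)) hi2
      (⟨i, hi2.trans_le (colLen_le hμ j2)⟩ : Fin n)
    have h4 := Finset.card_le_card (Finset.filter_subset_filter
      (fun x => x ≤ keyEntry μ π ⟨i, hi2.trans_le (colLen_le hμ j2)⟩ j2)
      (firstEntries_mono π (μ.colLen_anti j1 j2 hj.le)))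
    rw [← keyEntry.eq_def μ π ⟨i, hi2.trans_le (colLen_le hμ j2)⟩ j2] at h3
    omega
  col_strict' := by
    intro i1 i2 j hi h2
    have h1 : (i1, j) ∈ μ := μ.up_left_mem hi.le le_rfl h2
    rw [dif_pos h1, dif_pos h2]
    exact Fin.lt_def.1 (rankLargest_strictMono (card_firstEntries hπ (colLen_le hμ j)) hi
      (YoungDiagram.mem_iff_lt_colLen.1 h2) _ _)
  zeros' := fun h => dif_neg h

theorem keyTableau_apply (hμ : μ.colLen 0 ≤ n) (hπ : Function.Injective π) {i : Fin n} {j : ℕ}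
    (h : ((i : ℕ), j) ∈ μ) : keyTableau hμ hπ i j = keyEntry μ π i j :=
  dif_pos h

/-- The columns of a key are nested, so scanning fixes it. -/
theorem keyTableau_mem_demazureSet (hμ : μ.colLen 0 ≤ n) (hπ : Function.Injective π) :
    keyTableau hμ hπ ∈ demazureSet μ π := by
  have hn : ∀ {i j : ℕ}, i < μ.colLen j → i < n := fun h => h.trans_le (colLen_le hμ _)
  rw [mem_demazureSet, mem_tableaux]
  constructor
  · intro i j h
    rw [keyTableau_apply hμ hπ (i := ⟨i, hn (YoungDiagram.mem_iff_lt_colLen.1 h)⟩) h]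
    exact Fin.isLt _
  · intro i j h
    rw [← keyTableau_apply hμ hπ h]
    refine (scan_eq_self _ ?_ (YoungDiagram.mem_iff_lt_colLen.1 h)).le
    intro j j' hj x hx
    obtain ⟨i, hi, rfl⟩ := (mem_columnUp _).1 hx
    rw [keyTableau_apply hμ hπ (i := ⟨i, hn hi⟩) (YoungDiagram.mem_iff_lt_colLen.2 hi)]
    have h1 := rankLargest_mem (card_firstEntries hπ (colLen_le hμ j')) hi (⟨i, hn hi⟩ : Fin n)
    have h2 := firstEntries_mono π (μ.colLen_anti j j' hj.le) h1
    obtain ⟨k, hk, hk'⟩ := exists_rankLargest_eq (card_firstEntries hπ (colLen_le hμ j)) h2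
    refine (mem_columnUp _).2 ⟨k, hk, ?_⟩
    rw [keyTableau_apply hμ hπ (i := ⟨k, hn hk⟩) (YoungDiagram.mem_iff_lt_colLen.2 hk)]
    exact congrArg Fin.val (hk' _)

theorem le_keyEntry_of_mem_demazureSet {T : SemistandardYoungTableau μ}
    (hT : T ∈ demazureSet μ π) {i : Fin n} {j : ℕ} (h : ((i : ℕ), j) ∈ μ) :
    T i j ≤ keyEntry μ π i j :=
  (le_scan T (YoungDiagram.mem_iff_lt_colLen.1 h)).trans ((mem_demazureSet.1 hT).2 i j h)

theorem firstEntries_subset_of_keyEntry (hμ : μ.colLen 0 ≤ n) (hπ : Function.Injective π)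
    (hπ' : Function.Injective π') {j : ℕ}
    (h : ∀ i : Fin n, ((i : ℕ), j) ∈ μ → keyEntry μ π i j = keyEntry μ π' i j) :
    firstEntries π (μ.colLen j) ⊆ firstEntries π' (μ.colLen j) := by
  intro v hv
  obtain ⟨k, hk, hk'⟩ := exists_rankLargest_eq (card_firstEntries hπ (colLen_le hμ j)) hv
  rw [← hk' ⟨k, hk.trans_le (colLen_le hμ j)⟩]
  have := h ⟨k, hk.trans_le (colLen_le hμ j)⟩ (YoungDiagram.mem_iff_lt_colLen.2 hk)
  simp only [keyEntry] at this
  rw [this]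
  exact rankLargest_mem (card_firstEntries hπ' (colLen_le hμ j)) hk _

theorem firstEntries_eq_univ (hπ : Function.Injective π) : firstEntries π n = Finset.univ := by
  ext v
  obtain ⟨k, hk⟩ := Finite.surjective_of_injective hπ v
  simp only [Finset.mem_univ, iff_true]
  exact mem_firstEntries.2 ⟨k, k.isLt, hk⟩

/-- An `R`-permutation is determined by the sets of its first entries up to the ends of carrels. -/
theorem IsRPermutation.eq_of_firstEntries {R : Finset ℕ} (hπ : IsRPermutation R π)
    (hπ' : IsRPermutation R π')
    (h : ∀ q, IsEnd n R q → firstEntries π q = firstEntries π' q) : π = π' := by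
  have aux : ∀ {σ τ : Fin n → Fin n}, IsRPermutation R σ → IsRPermutation R τ →
      (∀ q, IsEnd n R q → firstEntries σ q = firstEntries τ q) → ∀ i : Fin n,
      (∀ k < i, σ k = τ k) → τ i ≤ σ i := by
    intro σ τ hσ hτ hq i ih
    have hi := Fin.le_def.1 (le_carrelLast (R := R) i)
    -- Thus `σ i = τ k` for some `k` up to the end of the carrel. Agreement before `i` and
    -- injectivity exclude `k < i`, and `τ` increases from `i` on.
    have h1 : σ i ∈ firstEntries τ (carrelLast R i + 1) := by
      rw [← hq _ (isEnd_carrelLast i)]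
      exact mem_firstEntries.2 ⟨i, by omega, rfl⟩
    obtain ⟨k, hk, hk'⟩ := mem_firstEntries.1 h1
    rw [← hk']
    rcases lt_trichotomy k i with h2 | h2 | h2
    · rw [← ih k h2] at hk'
      exact absurd (hσ.1 hk') h2.ne
    · rw [h2]
    · exact (hτ.2 i k h2 (sameCarrel_of_between ((carrelFirst_le i).trans h2.le)
        (Fin.le_def.2 (by omega)))).le
  have main : ∀ (m : ℕ) (i : Fin n), (i : ℕ) = m → π i = π' i := by
    intro m
    induction m using Nat.strong_induction_on with
    | _ m ih =>
      intro i hi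
      have ih' : ∀ k < i, π k = π' k := fun k hk =>
        ih k (by rw [Fin.lt_def] at hk; omega) k rfl
      exact le_antisymm (aux hπ' hπ (fun q hq => (h q hq).symm) i fun k hk => (ih' k hk).symm)
        (aux hπ hπ' h i ih')
  exact funext fun i => main i i rfl

/-- Each key belongs to the other Demazure set and so lies below the other key; the keys agree, and
their columns determine the permutation. -/
theorem eq_of_demazureSet_eq (hμ : μ.colLen 0 ≤ n) (hπ : IsRPermutation (colLengths n μ) π)
    (hπ' : IsRPermutation (colLengths n μ) π') (h : demazureSet μ π = demazureSet μ π') :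
    π = π' := by
  have hkey : ∀ (i : Fin n) (j : ℕ), ((i : ℕ), j) ∈ μ →
      keyEntry μ π i j = keyEntry μ π' i j := by
    intro i j hij
    have h1 := le_keyEntry_of_mem_demazureSet (h ▸ keyTableau_mem_demazureSet hμ hπ.1) hij
    have h2 := le_keyEntry_of_mem_demazureSet (h.symm ▸ keyTableau_mem_demazureSet hμ hπ'.1) hij
    rw [keyTableau_apply hμ _ hij] at h1 h2
    exact Fin.ext (le_antisymm h1 h2)
  refine hπ.eq_of_firstEntries hπ' ?_
  rintro q (hq | rfl)
  · obtain ⟨hq1, _⟩ := Finset.mem_filter.1 hq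
    obtain ⟨j, _, rfl⟩ := Finset.mem_image.1 hq1
    exact (firstEntries_subset_of_keyEntry hμ hπ.1 hπ'.1 fun i hi => hkey i j hi).antisymm
      (firstEntries_subset_of_keyEntry hμ hπ'.1 hπ.1 fun i hi => (hkey i j hi).symm)
  · rw [firstEntries_eq_univ hπ.1, firstEntries_eq_univ hπ'.1]

end Key

/-! ### Sums over tableaux -/

section Sums

variable {n : ℕ} {μ : YoungDiagram}

/-- A sum is its support, so uniqueness up to identity among sums of all shapes is formal once
existence is known. -/
theorem TableauSum.Identical.eq {f g : TableauSum n} (h : f.Identical g) : f = g :=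
  TableauSum.ext h

theorem TableauSum.ofShape_identical_iff {P Q : Finset (SemistandardYoungTableau μ)} :
    (TableauSum.ofShape n P).Identical (TableauSum.ofShape n Q) ↔ P = Q :=
  (Finset.map_injective _).eq_iff

/-- For a gapless core tuple `η`, the row bound set is the Demazure set of `Π(Δ(η))`. -/
theorem IsGaplessCore.exists_demazureSet {η : Fin n → Fin n} (hμ : μ.colLen 0 ≤ n)
    (hη : IsGaplessCore (colLengths n μ) η) :
    IsR312Avoiding (colLengths n μ)
      (gaplessToPerm (colLengths n μ) (core (colLengths n μ) η)) ∧
    rankTuple (colLengths n μ) (gaplessToPerm (colLengths n μ) (core (colLengths n μ) η)) =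
      core (colLengths n μ) η ∧
    rowBoundSet μ η =
      demazureSet μ (gaplessToPerm (colLengths n μ) (core (colLengths n μ) η)) := by
  have hU := isUpper_core (R := colLengths n μ) hη.1
  have hI := isRIncreasing_core (R := colLengths n μ) hη.1
  have hR := hasRuns_core hη
  have h312 := isR312Avoiding_gaplessToPerm hU hI hR
  have hrank := rankTuple_gaplessToPerm hU hI hR
  have hflag := isUpperFlag_ceiling hη
  have hcore := core_ceiling (R := colLengths n μ) hη.1
  refine ⟨h312, hrank, ?_⟩
  rw [demazureSet_eq_rowBoundSet hμ h312 hflag (hcore.trans hrank.symm)]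
  exact rowBoundSet_eq_of_core_eq hμ hη.1 hflag.1 hcore.symm

/-- For a 312-avoiding permutation, the ceiling of its rank tuple is a flag with the same core, and
the row bound set of either is the Demazure set. -/
theorem IsR312Avoiding.exists_rowBoundSet {π : Fin n → Fin n} (hμ : μ.colLen 0 ≤ n)
    (hπ : IsR312Avoiding (colLengths n μ) π) :
    IsUpperFlag (ceiling (colLengths n μ) (rankTuple (colLengths n μ) π)) ∧
    demazureSet μ π = rowBoundSet μ (ceiling (colLengths n μ) (rankTuple (colLengths n μ) π)) ∧
    demazureSet μ π = rowBoundSet μ (rankTuple (colLengths n μ) π) := by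
  have hg := hπ.isGapless_rankTuple
  have hflag := isUpperFlag_ceiling hg.1
  have hcore := core_ceiling (R := colLengths n μ) hg.1.1
  have hself := core_eq_self hg.1.1 hg.2
  have h1 := demazureSet_eq_rowBoundSet hμ hπ hflag (hcore.trans hself)
  exact ⟨hflag, h1, h1.trans (rowBoundSet_eq_of_core_eq hμ hflag.1 hg.1.1 hcore)⟩

end Sums

end ParabolicCatalan

open ParabolicCatalan
theorem theorem10p2 (n : ℕ) (hn : 1 ≤ n) (μ : YoungDiagram) (hμ : μ.colLen 0 ≤ n) :
    (∀ η : Fin n → Fin n, IsGaplessCore (colLengths n μ) η →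
      ∀ π : Fin n → Fin n, π = gaplessToPerm (colLengths n μ) (core (colLengths n μ) η) →
        IsR312Avoiding (colLengths n μ) π ∧
        (rowBoundSum μ η).Identical (demazureSum μ π) ∧
        (rowBoundSum μ η).poly = (demazureSum μ π).poly) ∧
    (∀ π : Fin n → Fin n, IsR312Avoiding (colLengths n μ) π →
      ∀ γ : Fin n → Fin n, γ = rankTuple (colLengths n μ) π →
        IsGapless (colLengths n μ) γ ∧
        (demazureSum μ π).Identical (rowBoundSum μ γ) ∧
        (demazureSum μ π).poly = (rowBoundSum μ γ).poly) ∧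
    (∀ φ : Fin n → Fin n, IsUpperFlag φ →
      (∃! d : TableauSum n, IsDemazure d ∧ (rowBoundSum μ φ).Identical d) ∧
      ∃! π : Fin n → Fin n, IsRPermutation (colLengths n μ) π ∧
        (rowBoundSum μ φ).Identical (demazureSum μ π)) ∧
    (∀ π : Fin n → Fin n, IsR312Avoiding (colLengths n μ) π →
      (∃! f : TableauSum n, IsFlagSchur f ∧ (demazureSum μ π).Identical f) ∧
      ∀ φ φ' : Fin n → Fin n, IsUpperFlag φ → IsUpperFlag φ' →
        (demazureSum μ π).Identical (rowBoundSum μ φ) →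
        (demazureSum μ π).Identical (rowBoundSum μ φ') →
        core (colLengths n μ) φ = core (colLengths n μ) φ') := by
  refine ⟨?_, ?_, ?_, ?_⟩
  · rintro η hη π rfl
    obtain ⟨h1, _, h3⟩ := hη.exists_demazureSet hμ
    have hid := (TableauSum.ofShape_identical_iff (n := n)).2 h3
    exact ⟨h1, hid, congrArg TableauSum.poly hid.eq⟩
  · rintro π hπ γ rfl
    have hid := (TableauSum.ofShape_identical_iff (n := n)).2 (hπ.exists_rowBoundSet hμ).2.2
    exact ⟨hπ.isGapless_rankTuple, hid, congrArg TableauSum.poly hid.eq⟩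
  · intro φ hφ
    obtain ⟨h1, _, h3⟩ := (IsUpperFlag.isGaplessCore (R := colLengths n μ) hφ).exists_demazureSet hμ
    have hid := (TableauSum.ofShape_identical_iff (n := n)).2 h3
    refine ⟨⟨_, ⟨⟨μ, _, hμ, h1.1, rfl⟩, hid⟩, fun d hd => ?_⟩, ⟨_, ⟨h1.1, hid⟩, fun σ hσ => ?_⟩⟩
    · exact hd.2.eq.symm.trans hid.eq
    · exact eq_of_demazureSet_eq hμ hσ.1 h1.1
        ((TableauSum.ofShape_identical_iff.1 hσ.2).symm.trans h3)
  · intro π hπ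
    obtain ⟨h1, h2, _⟩ := hπ.exists_rowBoundSet hμ
    have hid := (TableauSum.ofShape_identical_iff (n := n)).2 h2
    refine ⟨⟨_, ⟨⟨μ, _, hμ, h1, rfl⟩, hid⟩, fun f hf => hf.2.eq.symm.trans hid.eq⟩, ?_⟩
    -- The row bound set of `φ` is also the Demazure set of `gaplessToPerm` applied to the core of
    -- `φ`. Uniqueness identifies that permutation with `π`, and its rank tuple recovers the core.
    have key : ∀ φ : Fin n → Fin n, IsUpperFlag φ →
        (demazureSum μ π).Identical (rowBoundSum μ φ) →
        core (colLengths n μ) φ = rankTuple (colLengths n μ) π := by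
      intro φ hφ h
      obtain ⟨h3, h4, h5⟩ :=
        (IsUpperFlag.isGaplessCore (R := colLengths n μ) hφ).exists_demazureSet hμ
      rw [eq_of_demazureSet_eq hμ hπ.1 h3.1 ((TableauSum.ofShape_identical_iff.1 h).trans h5), h4]
    intro φ φ' hφ hφ' h h'
    rw [key φ hφ h, key φ' hφ' h']
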